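/- Let $\Lambda$ be the ring of symmetric functions over the field $\mathbb Q(t)$, i.e. $\Lambda=\mathbb Q(t)[p_1,p_2,\dots]$ with $p_n$ the power sums and $h_r$ the complete symmetric functions ($h_r=0$ for $r<0$, and $s_r=h_r$). For a scalar sequence $(c_n)$ the plethysm $p_n\mapsto c_np_n$ defines $f[X(t-1)]$, $f[X(1-t)]$ and $f[X/(1-t)]$ with $c_n=t^n-1$, $1-t^n$ and $(1-t^n)^{-1}$ respectively. Let $\langle p_\lambda,p_\mu\rangle=\delta_{\lambda\mu}z_\lambda$ be the Hall scalar product and $f^\perp$ the adjoint of multiplication by $f$. Let $Q_\lambda[X;t]=\prod_{i<j}\frac{1-R_{ij}}{1-tR_{ij}}\,q_\lambda$ be the Hall–Littlewood functions, where $q_r=h_r[X(1-t)]$ and $R_{ij}$ raises the $i$-th index by one and lowers the $j$-th index by one, and let $H_\lambda[X;t]=Q_\lambda[X/(1-t);t]$ be the modified Hall–Littlewood functions. For a positive integer $k$, call a partition $\lambda$ $k$-bounded if $\lambda_1\le k$, and let $\Lambda_t^{(k)}$ be the $\mathbb Q(t)$-linear span of $\{H_\lambda[X;t] : \lambda_1\le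 k\}$. For $r\in\mathbb Z$ let $B_r=\sum_{i\ge 0}s_{i+r}[X]\;s_i[X(t-1)]^{\perp}$, and for a partition $\lambda$ of length $m$ let $B_\lambda=\prod_{1\le i<j\le m}(1-te_{ij})\,B_{\lambda_1}\cdots B_{\lambda_m}$, where $e_{ij}$ replaces the indices $\lambda_i,\lambda_j$ by $\lambda_i+1,\lambda_j-1$. For a sequence of partitions put $\mathcal H_{()}=1$ and $\mathcal H_{(\lambda^{(1)},\lambda^{(2)},\dots)}=B_{\lambda^{(1)}}\mathcal H_{(\lambda^{(2)},\dots)}$. The $k$-split $\lambda^{\to k}=(\lambda^{(1)},\dots,\lambda^{(r)})$ of a $k$-bounded partition $\lambda$ is obtained by cutting $\lambda$, without rearranging its parts, into consecutive partitions such that the main hook-length $\lambda^{(i)}_1+\ell(\lambda^{(i)})-1$ equals $k$ for $i<r$ and is at most $k$ for $i=r$. The $k$-split polynomials are $G^{(k)}_\lambda[X;t]=\mathcal H_{\lambda^{\to k}}[X;t]$. **Theorem.** For every positive integer $k$, the $k$-split polynomials $G^{(k)}_\lambda[X;t]$, indexed by the $k$-bounded partitions $\lambda$, lie in $\Lambda_t^{(k)}$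 and form a basis of $\Lambda_t^{(k)}$ over $\mathbb Q(t)$. Moreover, for every $k$-bounded partition $\lambda$, $$G^{(k)}_\lambda[X;t]=H_\lambda[X;t]+\sum_{\mu>\lambda,\ \mu_1\le k}g^{(k)}_{\lambda\mu}(t)\,H_\mu[X;t],\qquad g^{(k)}_{\lambda\mu}(t)\in\mathbb Z[t],$$ where $\mu>\lambda$ is the strict dominance order on partitions of the same size. -/

import Mathlib

noncomputable section

namespace KSplit

/-- The field of scalars, rational functions in `t` with rational coefficients. -/
abbrev Scalar : Type := RatFunc ℚ

/-- The parameter `t`. -/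
abbrev t : Scalar := RatFunc.X

/-- The ring of symmetric functions with coefficients in `ℚ(t)`, presented as the polynomial ring
in the power sums: the variable with index `n ≥ 1` is the power sum `p_n`. -/
abbrev Sym : Type := MvPolynomial ℕ+ Scalar

/-- The power sum `p_n`. -/
def powerSum (n : ℕ+) : Sym := MvPolynomial.X n

/-- The complete symmetric function `h_r` with `r ≥ 0`, expressed in power sums by
`h_0 = 1` and `r h_r = p_1 h_{r-1} + p_2 h_{r-2} + ⋯ + p_r h_0`. -/
def completeNat : ℕ → Sym
  | 0 => 1
  | r + 1 => ((r : Scalar) + 1)⁻¹ •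
      ∑ i : Fin (r + 1), powerSum (Nat.succPNat (i : ℕ)) * completeNat (r - (i : ℕ))

/-- The complete symmetric function `h_r`, which is the Schur function `s_r` of one row, for
every integer `r`; it vanishes for `r < 0`. -/
def complete (r : ℤ) : Sym := if r < 0 then 0 else completeNat r.toNat

/-! ### Plethystic substitutions -/

/-- The plethystic substitution which sends `p_n` to `c n * p_n` and fixes the scalars. -/
def scaleAlphabet (c : ℕ+ → Scalar) : Sym →ₐ[Scalar] Sym :=
  MvPolynomial.aeval fun n => c n • powerSum n

/-- `f ↦ f[X(t - 1)]`. -/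
def timesTSubOne : Sym →ₐ[Scalar] Sym := scaleAlphabet fun n => t ^ (n : ℕ) - 1

/-- `f ↦ f[X(1 - t)]`. -/
def timesOneSubT : Sym →ₐ[Scalar] Sym := scaleAlphabet fun n => 1 - t ^ (n : ℕ)

/-- `f ↦ f[X/(1 - t)]`. -/
def divOneSubT : Sym →ₐ[Scalar] Sym := scaleAlphabet fun n => (1 - t ^ (n : ℕ))⁻¹

/-! ### The Hall scalar product and adjoints of multiplications -/

/-- `z_λ = ∏ n ^ m_n * m_n !` for the partition with `m n` parts equal to `n`. -/
def zee (m : ℕ+ →₀ ℕ) : Scalar :=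
  m.prod fun n e => ((n : ℕ) : Scalar) ^ e * (e.factorial : Scalar)

theorem zee_ne_zero (m : ℕ+ →₀ ℕ) : zee m ≠ 0 := by
  unfold zee Finsupp.prod
  refine Finset.prod_ne_zero_iff.mpr fun n _ => mul_ne_zero (pow_ne_zero _ ?_) ?_
  · exact_mod_cast n.ne_zero
  · exact_mod_cast Nat.factorial_ne_zero _

/-- The scalar product with `⟨p_λ, p_μ⟩ = δ_{λμ} z_λ`. -/
def hall (f g : Sym) : Scalar :=
  ∑ m ∈ f.support, f.coeff m * g.coeff m * zee m

/-- The operator `f^⊥`, given on power sum products by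
`p_λ^⊥ p_μ = (z_μ / z_ν) p_ν` if `p_μ = p_λ p_ν`, and `p_λ^⊥ p_μ = 0` if `p_λ` does not
divide `p_μ`. -/
def perp (f g : Sym) : Sym :=
  ∑ a ∈ f.support, ∑ b ∈ g.support,
    if a ≤ b then
      MvPolynomial.monomial (b - a) (f.coeff a * g.coeff b * (zee b / zee (b - a)))
    else 0

theorem hall_monomial_right (f : Sym) (m : ℕ+ →₀ ℕ) (c : Scalar) :
    hall f (MvPolynomial.monomial m c) = f.coeff m * c * zee m := by
  classical
  unfold hall
  rw [Finset.sum_eq_single m]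
  · simp
  · intro b _ hb
    simp [MvPolynomial.coeff_monomial, hb.symm]
  · intro h
    simp [MvPolynomial.notMem_support_iff.mp h]

theorem hall_add_right (f g h : Sym) : hall f (g + h) = hall f g + hall f h := by
  unfold hall
  rw [← Finset.sum_add_distrib]
  refine Finset.sum_congr rfl fun m _ => ?_
  rw [MvPolynomial.coeff_add]
  ring

theorem coeff_perp (f g : Sym) (c : ℕ+ →₀ ℕ) :
    (perp f g).coeff c = ∑ a ∈ f.support, f.coeff a * g.coeff (a + c) * (zee (a + c) / zee c) := by
  classical
  unfold perp
  rw [MvPolynomial.coeff_sum]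
  refine Finset.sum_congr rfl fun a _ => ?_
  rw [MvPolynomial.coeff_sum, Finset.sum_eq_single (a + c)]
  · simp
  · intro b _ hb
    split_ifs with hab
    · rw [MvPolynomial.coeff_monomial, if_neg]
      rintro rfl
      exact hb (add_tsub_cancel_of_le hab).symm
    · simp
  · intro h
    simp [MvPolynomial.notMem_support_iff.mp h]

/-- `f^⊥` is the adjoint of the multiplication by `f`. -/
theorem hall_perp (f g h : Sym) : hall (perp f g) h = hall g (f * h) := by
  classical
  induction h using MvPolynomial.induction_on' with
  | monomial c x =>
    rw [hall_monomial_right, coeff_perp]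
    have key : hall g (f * MvPolynomial.monomial c x)
        = ∑ a ∈ f.support, hall g (MvPolynomial.monomial (a + c) (f.coeff a * x)) := by
      have hsum : ∀ (s : Finset (ℕ+ →₀ ℕ)) (F : (ℕ+ →₀ ℕ) → Sym),
          hall g (∑ a ∈ s, F a) = ∑ a ∈ s, hall g (F a) := by
        intro s F
        induction s using Finset.induction_on with
        | empty => simp [hall]
        | insert a s ha ih => rw [Finset.sum_insert ha, Finset.sum_insert ha, hall_add_right, ih]
      rw [← hsum]
      conv_lhs => rw [f.as_sum, Finset.sum_mul]
      simp [MvPolynomial.monomial_mul]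
    rw [key, Finset.sum_mul, Finset.sum_mul]
    refine Finset.sum_congr rfl fun a _ => ?_
    rw [hall_monomial_right]
    have := zee_ne_zero c
    field_simp
  | add p q hp hq => rw [mul_add, hall_add_right, hall_add_right, hp, hq]

/-! ### Partitions -/

/-- A partition, as the weakly decreasing list of its positive parts. -/
def IsPartition (l : List ℕ) : Prop := l.SortedGE ∧ ∀ x ∈ l, 0 < x

/-- The partitions all of whose parts are at most `k`. -/
abbrev BoundedPartition (k : ℕ) : Type :=
  {l : List ℕ // IsPartition l ∧ ∀ x ∈ l, x ≤ k}

/-- The strict dominance order `l < m` on partitions. -/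
def DominanceLT (l m : List ℕ) : Prop :=
  l ≠ m ∧ l.sum = m.sum ∧ ∀ i : ℕ, (l.take i).sum ≤ (m.take i).sum

/-- The `k`-split of a `k`-bounded partition: a block that starts with the part `a` consists of
`k - a + 1` consecutive parts, so that its main hook-length `a + (k - a + 1) - 1` is `k`; the last
block contains what is left, and may be shorter. -/
def kSplit (k : ℕ) : List ℕ → List (List ℕ)
  | [] => []
  | a :: l => (a :: l.take (k - a)) :: kSplit k (l.drop (k - a))
termination_by l => l.length
decreasing_by simp only [List.length_drop, List.length_cons]; omega

/-! ### Hall-Littlewood functions -/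

/-- The positions `(i, j)` with `i < j`. -/
abbrev IndexPair (m : ℕ) : Type := {p : Fin m × Fin m // p.1 < p.2}

/-- The vector `∑ n_{ij} (ε_i - ε_j)` that the raising operator `∏ R_{ij} ^ n_{ij}` adds to an
index vector. -/
def raise {m : ℕ} (n : IndexPair m → ℕ) : Fin m → ℤ :=
  ∑ p : IndexPair m, (n p : ℤ) • (Pi.single p.1.1 1 - Pi.single p.1.2 1)

/-- The coefficient of `R ^ n` in `(1 - R) / (1 - t R) = 1 + ∑_{n ≥ 1} (t ^ n - t ^ (n - 1)) R ^ n`.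
-/
def raisingCoeff (n : ℕ) : Scalar := if n = 0 then 1 else t ^ n - t ^ (n - 1)

/-- The Hall-Littlewood function `Q_λ[X;t] = ∏_{i < j} (1 - R_{ij}) / (1 - t R_{ij}) q_λ`, where
`q_α = q_{α_1} q_{α_2} ⋯` and `q_r = h_r[X(1 - t)]`. The raising operators act on index vectors
before these are turned into products; all but finitely many terms vanish, since `q_r = 0` for
`r < 0`. -/
def hallLittlewoodQ (l : List ℕ) : Sym :=
  ∑ᶠ n : IndexPair l.length → ℕ,
    (∏ p, raisingCoeff (n p)) •
      ∏ i : Fin l.length, timesOneSubT (complete ((l.get i : ℤ) + raise n i))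

/-- The modified Hall-Littlewood function `H_λ[X;t] = Q_λ[X/(1 - t);t]`. -/
def hallLittlewoodH (l : List ℕ) : Sym := divOneSubT (hallLittlewoodQ l)

/-- `Λ_t^(k)`, the linear span of the `H_λ[X;t]` for the `k`-bounded partitions `λ`. -/
def LambdaT (k : ℕ) : Submodule Scalar Sym :=
  Submodule.span Scalar (Set.range fun l : BoundedPartition k => hallLittlewoodH l.1)

/-! ### Vertex operators and `k`-split polynomials -/

/-- The operator `B_r = ∑_{i ≥ 0} s_{i + r}[X] s_i[X(t - 1)]^⊥` for an integer `r`. On each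
symmetric function all but finitely many terms vanish. -/
def vertexB (r : ℤ) (f : Sym) : Sym :=
  ∑ᶠ i : ℕ, complete ((i : ℤ) + r) * perp (timesTSubOne (complete (i : ℤ))) f

/-- The operator `B_λ = ∏_{i < j} (1 - t e_{ij}) B_{λ_1} ⋯ B_{λ_m}`, where `e_{ij}` raises the
`i`-th index by one and lowers the `j`-th index by one. The product is expanded over the sets `E` of
pairs from which the term `- t e_{ij}` is taken. -/
def partitionB (l : List ℕ) (f : Sym) : Sym :=
  ∑ E : Finset (IndexPair l.length),
    (-t) ^ E.card •
      (List.ofFn fun i : Fin l.length =>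
        (l.get i : ℤ) + raise (fun p => if p ∈ E then 1 else 0) i).foldr vertexB f

/-- The generalized Schur function product of a sequence of partitions:
`𝓗_() = 1` and `𝓗_(λ¹, λ², …) = B_{λ¹} 𝓗_(λ², …)`. -/
def generalizedSchur : List (List ℕ) → Sym
  | [] => 1
  | l :: S => partitionB l (generalizedSchur S)

/-- The `k`-split polynomial `G_λ^(k)[X;t]`. -/
def kSplitPoly (k : ℕ) (l : List ℕ) : Sym := generalizedSchur (kSplit k l)

end KSplit

end

noncomputable section

namespace KSplit

open MvPolynomial

/-! ### The Hall scalar product and its adjoints -/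

/-! The argument rests on writing $H_\lambda = B_{\lambda_1}B_{\lambda_2}\cdots 1$
(`hallLittlewoodH_eq_vertexWord`). The map $f\mapsto f[X+(t-1)u]$ is multiplicative, so $B_a$
applied to a product of $h$'s produces exactly the factors $(1-R_{0j})/(1-tR_{0j})$ of a new first
index.

The $B_r$ satisfy a quadratic relation (`vertexB_comm`). It replaces an ascent $m<n$ in a word by
pairs with the same sum, a larger first entry and no entry above $n$. Hence a word with entries at
most $k$ straightens into $k$-bounded $H_\mu$ with coefficients in $\mathbb Z[t]$, where every $\mu$
dominates the word (`hasExpansion_vertexWord`).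

Expanding $B_\lambda$ for a block raises each entry by less than the length of the block, so the
bound $k$ on the main hook-length keeps all entries at most $k$ (`raisedIndex_le`). The unraised
term carries $H_\lambda$, and every other term strictly increases some partial sum. Induction along
the blocks gives the triangular expansion (`hasExpansion_kSplitPoly_sub`).

The $H_\lambda$ are independent because they are unitriangular over the products of complete
functions, ordered by the sum of squares of the parts. Dominance triangularity, refined to a
numerical rank bounded in each degree, then makes the $k$-split polynomials a basis. -/

theorem hall_eq_sum (f g : Sym) {s : Finset (ℕ+ →₀ ℕ)} (hs : f.support ⊆ s) :
    hall f g = ∑ m ∈ s, f.coeff m * g.coeff m * zee m := by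
  unfold hall
  refine Finset.sum_subset hs fun m _ hm => ?_
  rw [MvPolynomial.notMem_support_iff.mp hm, zero_mul, zero_mul]

theorem hall_comm (f g : Sym) : hall f g = hall g f := by
  classical
  rw [hall_eq_sum f g (Finset.subset_union_left (s₂ := g.support)),
    hall_eq_sum g f (Finset.subset_union_right (s₁ := f.support))]
  exact Finset.sum_congr rfl fun m _ => by ring

theorem hall_smul_right (f g : Sym) (c : Scalar) : hall f (c • g) = c * hall f g := by
  unfold hall
  rw [Finset.mul_sum]
  refine Finset.sum_congr rfl fun m _ => ?_
  rw [MvPolynomial.coeff_smul, smul_eq_mul]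
  ring

theorem hall_add_left (f g h : Sym) : hall (f + g) h = hall f h + hall g h := by
  rw [hall_comm, hall_add_right, hall_comm h f, hall_comm h g]

theorem hall_smul_left (f g : Sym) (c : Scalar) : hall (c • f) g = c * hall f g := by
  rw [hall_comm, hall_smul_right, hall_comm]

theorem eq_of_hall_eq {f g : Sym} (H : ∀ h, hall f h = hall g h) : f = g := by
  ext m
  have := H (MvPolynomial.monomial m 1)
  rw [hall_monomial_right, hall_monomial_right] at this
  simpa [zee_ne_zero] using this

theorem perp_add_right (f g h : Sym) : perp f (g + h) = perp f g + perp f h :=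
  eq_of_hall_eq fun u => by simp only [hall_perp, hall_add_left]

theorem perp_smul_right (f g : Sym) (c : Scalar) : perp f (c • g) = c • perp f g :=
  eq_of_hall_eq fun u => by simp only [hall_perp, hall_smul_left]

theorem perp_add_left (f g h : Sym) : perp (f + g) h = perp f h + perp g h :=
  eq_of_hall_eq fun u => by simp only [hall_perp, hall_add_left, add_mul, hall_add_right]

theorem perp_smul_left (f g : Sym) (c : Scalar) : perp (c • f) g = c • perp f g :=
  eq_of_hall_eq fun u => by
    simp only [hall_perp, hall_smul_left, smul_mul_assoc, hall_smul_right]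

theorem perp_zero_left (g : Sym) : perp 0 g = 0 := by
  simpa using perp_smul_left 0 g 0

theorem perp_zero_right (f : Sym) : perp f 0 = 0 := by
  simpa using perp_smul_right f 0 0

theorem perp_sum_left {ι : Type*} (s : Finset ι) (f : ι → Sym) (g : Sym) :
    perp (∑ i ∈ s, f i) g = ∑ i ∈ s, perp (f i) g :=
  map_sum (AddMonoidHom.mk' (fun u => perp u g) fun a b => perp_add_left a b g) f s

theorem perp_mul (f g h : Sym) : perp (f * g) h = perp g (perp f h) :=
  eq_of_hall_eq fun u => by simp only [hall_perp, mul_assoc]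

theorem perp_comm (f g h : Sym) : perp f (perp g h) = perp g (perp f h) := by
  rw [← perp_mul, ← perp_mul, mul_comm]

theorem perp_one (g : Sym) : perp 1 g = g :=
  eq_of_hall_eq fun u => by rw [hall_perp, one_mul]

/-- The derivation `n ∂/∂p_n`, which is adjoint to the multiplication by `p_n`. -/
def powerSumPerp (n : ℕ+) : Derivation Scalar Sym Sym := ((n : ℕ) : Scalar) • pderiv n

theorem powerSumPerp_powerSum (n m : ℕ+) :
    powerSumPerp n (powerSum m) = if m = n then ((n : ℕ) : Scalar) • 1 else 0 := by
  unfold powerSumPerp powerSum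
  rw [Derivation.smul_apply, pderiv_X]
  split_ifs with h
  · subst h; simp
  · rw [Pi.single_eq_of_ne h]; simp

theorem zee_add_single (m : ℕ+ →₀ ℕ) (n : ℕ+) :
    zee (m + Finsupp.single n 1) = ((n : ℕ) : Scalar) * ((m n : Scalar) + 1) * zee m := by
  classical
  have key : ∀ m' : ℕ+ →₀ ℕ, m'.support ⊆ insert n m.support →
      zee m' = ∏ i ∈ insert n m.support, ((i : ℕ) : Scalar) ^ m' i * ((m' i).factorial : Scalar) :=
    fun m' h => Finsupp.prod_of_support_subset _ h _ (by simp)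
  rw [key m (Finset.subset_insert _ _), key (m + Finsupp.single n 1) ?_]
  · rw [← Finset.mul_prod_erase _ _ (Finset.mem_insert_self n m.support),
      ← Finset.mul_prod_erase _ _ (Finset.mem_insert_self n m.support)]
    rw [Finset.prod_congr rfl fun i hi => ?_]
    · simp only [Finsupp.add_apply, Finsupp.single_eq_same, Nat.factorial_succ, pow_succ]
      push_cast
      ring
    · simp [Finsupp.single_eq_of_ne (Finset.ne_of_mem_erase hi)]
  · refine Finsupp.support_add.trans (Finset.union_subset (Finset.subset_insert _ _) ?_)
    exact Finsupp.support_single_subset.trans (by simp)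

theorem hall_powerSum_mul (n : ℕ+) (f g : Sym) :
    hall (powerSum n * f) g = hall f (powerSumPerp n g) := by
  induction g using MvPolynomial.induction_on' with
  | monomial m c =>
    unfold powerSumPerp powerSum
    rw [Derivation.smul_apply, pderiv_monomial, hall_smul_right, hall_monomial_right,
      hall_monomial_right, coeff_X_mul']
    split_ifs with h
    · obtain ⟨m', rfl⟩ : ∃ m', m = m' + Finsupp.single n 1 := by
        refine ⟨m - Finsupp.single n 1, (tsub_add_cancel_of_le ?_).symm⟩
        rw [Finsupp.single_le_iff]
        exact Nat.one_le_iff_ne_zero.mpr (Finsupp.mem_support_iff.mp h)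
      rw [zee_add_single, add_tsub_cancel_right]
      simp only [Finsupp.add_apply, Finsupp.single_eq_same]
      push_cast
      ring
    · rw [Finsupp.notMem_support_iff.mp h]
      simp
  | add p q hp hq => rw [map_add, hall_add_right, hall_add_right, hp, hq]

theorem perp_powerSum_mul (n : ℕ+) (f g : Sym) :
    perp (powerSum n * f) g = perp f (powerSumPerp n g) :=
  eq_of_hall_eq fun u => by
    rw [hall_perp, hall_perp, mul_assoc, hall_comm, hall_powerSum_mul, hall_comm]

/-! ### The complete symmetric functions -/

theorem complete_of_neg {r : ℤ} (h : r < 0) : complete r = 0 := by simp [complete, h]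

theorem complete_zero : complete 0 = 1 := by simp [complete, completeNat]

/-- Newton's identity `r h_r = p_1 h_{r-1} + p_2 h_{r-2} + ⋯`. -/
theorem smul_complete (r : ℤ) (N : ℕ) (h : r ≤ N) :
    (r : Scalar) • complete r =
      ∑ i ∈ Finset.range N, powerSum (Nat.succPNat i) * complete (r - 1 - i) := by
  rcases lt_trichotomy r 0 with hr | rfl | hr
  · rw [complete_of_neg hr, smul_zero, Finset.sum_eq_zero]
    intro i _
    rw [complete_of_neg (by omega), mul_zero]
  · rw [Int.cast_zero, zero_smul, Finset.sum_eq_zero]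
    intro i _
    rw [complete_of_neg (by omega), mul_zero]
  · obtain ⟨s, rfl⟩ : ∃ s : ℕ, r = (s : ℤ) + 1 := ⟨(r - 1).toNat, by omega⟩
    have e : complete ((s : ℤ) + 1) = completeNat (s + 1) := by
      rw [complete, if_neg (by omega)]
      congr 1
    have hs : (s : Scalar) + 1 ≠ 0 := by exact_mod_cast Nat.succ_ne_zero s
    rw [e, completeNat]
    push_cast
    rw [smul_inv_smul₀ hs, Finset.sum_fin_eq_sum_range]
    have hsub : Finset.range (s + 1) ⊆ Finset.range N := Finset.range_mono (by omega)
    rw [← Finset.sum_subset hsub]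
    · refine Finset.sum_congr rfl fun i hi => ?_
      rw [Finset.mem_range] at hi
      rw [dif_pos hi, complete, if_neg (by omega),
        show ((s : ℤ) + 1 - 1 - i).toNat = s - i by omega]
    · intro i _ hi
      rw [Finset.mem_range] at hi
      rw [complete_of_neg (by omega), mul_zero]

/-- Differentiating Newton's identity gives $(r-n)h_{r-n}$ from the factors $h$ and $n h_{r-n}$ from
the factor $p_n$. The induction runs on a strict upper bound for $r$, so that negative $r$ form the
base case. -/
theorem powerSumPerp_complete (n : ℕ+) (r : ℤ) :
    powerSumPerp n (complete r) = complete (r - n) := by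
  have hn := n.pos
  obtain ⟨M, hM⟩ : ∃ M : ℕ, r < M := ⟨r.toNat + 1, by omega⟩
  induction M generalizing r with
  | zero => rw [complete_of_neg (by omega), map_zero, complete_of_neg (by omega)]
  | succ M ih =>
    rcases lt_trichotomy r 0 with hr | rfl | hr
    · rw [complete_of_neg hr, map_zero, complete_of_neg (by omega)]
    · rw [complete_zero, Derivation.map_one_eq_zero, complete_of_neg (by omega)]
    · have hr' : (r : Scalar) ≠ 0 := by exact_mod_cast hr.ne'
      refine smul_right_injective _ hr' ?_
      change (r : Scalar) • _ = (r : Scalar) • _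
      obtain ⟨N, hN, hN'⟩ : ∃ N : ℕ, r ≤ N ∧ (n : ℕ) ≤ N := ⟨r.toNat + n, by omega, by omega⟩
      rw [← Derivation.map_smul, smul_complete r N hN, map_sum]
      have step : ∀ i ∈ Finset.range N,
          powerSumPerp n (powerSum (Nat.succPNat i) * complete (r - 1 - i)) =
            powerSum (Nat.succPNat i) * complete (r - n - 1 - i) +
              if i = n - 1 then ((n : ℕ) : Scalar) • complete (r - n) else 0 := by
        intro i _
        rw [Derivation.leibniz, ih _ (by omega), powerSumPerp_powerSum, smul_eq_mul, smul_eq_mul]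
        congr 1
        · congr 2; ring
        · by_cases hi : i = n - 1
          · have : Nat.succPNat i = n := PNat.eq (by simp; omega)
            rw [if_pos this, if_pos hi, mul_smul_comm, mul_one]
            congr 2
            omega
          · have : Nat.succPNat i ≠ n := fun h => hi (by rw [← h]; simp)
            rw [if_neg this, if_neg hi, mul_zero]
      rw [Finset.sum_congr rfl step, Finset.sum_add_distrib, ← smul_complete _ N (by omega),
        Finset.sum_ite_eq', if_pos (by rw [Finset.mem_range]; omega), ← add_smul]
      congr 1
      push_cast
      ring

/-- The chain rule for $p_n\mapsto c_np_n$. -/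
theorem powerSumPerp_scaleAlphabet (c : ℕ+ → Scalar) (n : ℕ+) (f : Sym) :
    powerSumPerp n (scaleAlphabet c f) = c n • scaleAlphabet c (powerSumPerp n f) := by
  induction f using MvPolynomial.induction_on with
  | C a =>
    rw [← algebraMap_eq, AlgHom.commutes, Derivation.map_algebraMap, map_zero, smul_zero]
  | add p q hp hq => simp only [map_add, hp, hq, smul_add]
  | mul_X p m hp =>
    have hX : scaleAlphabet c (X m) = c m • powerSum m := by simp [scaleAlphabet]
    rw [map_mul, Derivation.leibniz, Derivation.leibniz, hp, hX, Derivation.map_smul]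
    change _ = c n • scaleAlphabet c (p • powerSumPerp n (powerSum m) + X m • powerSumPerp n p)
    rw [powerSumPerp_powerSum]
    simp only [map_add, map_mul, smul_eq_mul, hX]
    split_ifs with h
    · subst h
      simp only [map_smul, map_one, mul_smul_comm, smul_add, smul_mul_assoc]
    · simp only [smul_zero, mul_zero, map_zero, smul_add, mul_smul_comm, smul_mul_assoc]

/-! ### The skewing operators of the vertex operators -/

/-- The operator `s_i[X(t - 1)]^⊥`. -/
def skew (i : ℤ) (f : Sym) : Sym := perp (timesTSubOne (complete i)) f

theorem skew_zero (f : Sym) : skew 0 f = f := by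
  rw [skew, complete_zero, map_one, perp_one]

theorem skew_of_neg {i : ℤ} (h : i < 0) (f : Sym) : skew i f = 0 := by
  rw [skew, complete_of_neg h, map_zero, perp_zero_left]

theorem skew_comm (i j : ℤ) (f : Sym) : skew i (skew j f) = skew j (skew i f) := perp_comm _ _ _

/-- Adjoint form of the Leibniz rule for $p_n^\perp$, which sends $s_i[X(t-1)]$ to
$(t^n-1)s_{i-n}[X(t-1)]$. -/
theorem skew_powerSum_mul (i : ℤ) (n : ℕ+) (f : Sym) :
    skew i (powerSum n * f) = powerSum n * skew i f + (t ^ (n : ℕ) - 1) • skew (i - n) f := by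
  refine eq_of_hall_eq fun u => ?_
  simp only [skew, hall_add_left, hall_smul_left, hall_perp, hall_powerSum_mul, Derivation.leibniz,
    timesTSubOne, powerSumPerp_scaleAlphabet, powerSumPerp_complete, smul_eq_mul, hall_add_right,
    mul_comm u, smul_mul_assoc, hall_smul_right]

theorem skew_one (i : ℤ) : skew i 1 = if i = 0 then 1 else 0 := by
  split_ifs with h
  · rw [h, skew_zero]
  · rcases lt_or_gt_of_ne h with h | h
    · exact skew_of_neg h _
    · have hi : (i : Scalar) ≠ 0 := by exact_mod_cast h.ne'
      refine smul_right_injective _ hi ?_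
      change (i : Scalar) • _ = (i : Scalar) • _
      rw [skew, ← perp_smul_left, ← map_smul, smul_complete i i.toNat (by omega), map_sum,
        perp_sum_left, smul_zero]
      refine Finset.sum_eq_zero fun j _ => ?_
      have hX : timesTSubOne (powerSum (Nat.succPNat j)) =
          (t ^ (Nat.succPNat j : ℕ) - 1) • powerSum (Nat.succPNat j) := by
        simp [timesTSubOne, scaleAlphabet, powerSum]
      rw [map_mul, hX, smul_mul_assoc, perp_smul_left, perp_powerSum_mul,
        Derivation.map_one_eq_zero, perp_zero_right, smul_zero]

/-- This compares coefficients in $u F'(u)=F(u)\sum_{j\ge1}(t^j-1)u^j$ for $F=(1-u)/(1-tu)$; it is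
Newton's identity for the alphabet $t-1$. -/
theorem sum_raisingCoeff (i : ℕ) :
    ∑ j ∈ Finset.range i, (t ^ (j + 1) - 1) * raisingCoeff (i - 1 - j) = i * raisingCoeff i := by
  rcases i with _ | i
  · simp
  have h1 : ∀ M : ℕ, ∑ j ∈ Finset.range (M + 1), raisingCoeff j = t ^ M := by
    intro M
    induction M with
    | zero => simp [raisingCoeff]
    | succ M ih => rw [Finset.sum_range_succ, ih]; simp [raisingCoeff]
  have h2 : ∀ M ≤ i, ∑ j ∈ Finset.range (M + 1), t ^ (i + 1 - j) * raisingCoeff j =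
      t ^ (i + 1) + M * (t ^ (i + 1) - t ^ i) := by
    intro M hM
    induction M with
    | zero => simp [raisingCoeff]
    | succ M ih =>
      rw [Finset.sum_range_succ, ih (by omega), raisingCoeff, if_neg (by omega), mul_sub (t ^ (i + 1 - (M + 1))),
        ← pow_add, ← pow_add, show i + 1 - (M + 1) + (M + 1) = i + 1 by omega,
        show i + 1 - (M + 1) + (M + 1 - 1) = i by omega]
      push_cast
      ring
  rw [← Finset.sum_range_reflect]
  have h3 : ∀ j ∈ Finset.range (i + 1),
      (t ^ (i + 1 - 1 - j + 1) - 1) * raisingCoeff (i + 1 - 1 - (i + 1 - 1 - j)) =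
        t ^ (i + 1 - j) * raisingCoeff j - raisingCoeff j := by
    intro j hj
    rw [Finset.mem_range] at hj
    rw [show i + 1 - 1 - j + 1 = i + 1 - j by omega,
      show i + 1 - 1 - (i + 1 - 1 - j) = j by omega]
    ring
  rw [Finset.sum_congr rfl h3, Finset.sum_sub_distrib, h1, h2 i le_rfl, raisingCoeff,
    if_neg (by omega)]
  rw [Nat.add_sub_cancel]
  push_cast
  ring

/-- Each $p_j^\perp$ lowers the index of $h_n$ by $j$, so $s_i[X(t-1)]^\perp$ acts through the
scalar $s_i[t-1]$, which is the coefficient of $u^i$ in $(1-u)/(1-tu)$. This is the source of the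
raising-operator coefficients. -/
theorem skew_complete (i : ℕ) (n : ℤ) :
    skew i (complete n) = raisingCoeff i • complete (n - i) := by
  induction i using Nat.strong_induction_on generalizing n with
  | _ i ih =>
    rcases Nat.eq_zero_or_pos i with rfl | hi
    · simp [skew_zero, raisingCoeff]
    have hi' : (i : Scalar) ≠ 0 := by exact_mod_cast hi.ne'
    refine smul_right_injective _ hi' ?_
    change (i : Scalar) • _ = (i : Scalar) • _
    rw [smul_smul, ← sum_raisingCoeff, Finset.sum_smul]
    have := smul_complete (i : ℤ) i le_rfl
    rw [skew, ← perp_smul_left, ← map_smul]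
    rw [Int.cast_natCast] at this
    rw [this, map_sum, perp_sum_left]
    refine Finset.sum_congr rfl fun j hj => ?_
    rw [Finset.mem_range] at hj
    have hX : timesTSubOne (powerSum (Nat.succPNat j)) =
        (t ^ (j + 1) - 1) • powerSum (Nat.succPNat j) := by
      simp [timesTSubOne, scaleAlphabet, powerSum]
    rw [map_mul, hX, smul_mul_assoc, perp_smul_left, perp_powerSum_mul, powerSumPerp_complete]
    have := ih (i - 1 - j) (by omega) (n - Nat.succPNat j)
    rw [skew, show (((i - 1 - j : ℕ) : ℤ)) = (i : ℤ) - 1 - j by omega] at this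
    rw [this, mul_smul]
    congr 3
    simp only [Nat.succPNat_coe]
    push_cast
    ring

/-- The algebra homomorphism `f ↦ f[X + (t - 1) u] = ∑ i, s_i[X(t - 1)]^⊥ f u ^ i`. -/
def skewGen : Sym →ₐ[Scalar] Polynomial Sym :=
  MvPolynomial.aeval fun n =>
    Polynomial.C (powerSum n) + (t ^ (n : ℕ) - 1) • (Polynomial.X ^ (n : ℕ))

/-- Both sides agree on scalars and obey the same recursion under multiplication by a power sum.
Consequences used later are multiplicativity of the whole family of skewings and its finiteness on
each $f$. -/
theorem coeff_skewGen (f : Sym) (i : ℕ) : (skewGen f).coeff i = skew i f := by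
  induction f using MvPolynomial.induction_on generalizing i with
  | C a =>
    rw [← algebraMap_eq, AlgHom.commutes, Algebra.algebraMap_eq_smul_one,
      Algebra.algebraMap_eq_smul_one, Polynomial.coeff_smul, Polynomial.coeff_one, skew,
      perp_smul_right]
    change _ = a • skew i 1
    rw [skew_one]
    simp
  | add p q hp hq =>
    rw [map_add, Polynomial.coeff_add, hp, hq]
    exact (perp_add_right _ _ _).symm
  | mul_X p n hp =>
    rw [mul_comm]
    change _ = skew i (powerSum n * p)
    have hX : skewGen (X n) =
        Polynomial.C (powerSum n) + (t ^ (n : ℕ) - 1) • (Polynomial.X ^ (n : ℕ)) := by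
      simp [skewGen]
    rw [skew_powerSum_mul, map_mul, hX, add_mul, Polynomial.coeff_add, Polynomial.coeff_C_mul, hp,
      smul_mul_assoc, Polynomial.coeff_smul, Polynomial.coeff_X_pow_mul']
    split_ifs with h
    · rw [hp, Nat.cast_sub h]
    · rw [skew_of_neg (i := (i : ℤ) - (n : ℕ)) (by omega)]

/-! ### The vertex operators -/

theorem skew_zero_right (i : ℤ) : skew i 0 = 0 := perp_zero_right _

theorem skewGen_complete (n : ℤ) (N : ℕ) (h : n < N) :
    skewGen (complete n) = ∑ i ∈ Finset.range N,
      Polynomial.monomial i (raisingCoeff i • complete (n - i)) := by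
  ext1 i
  rw [coeff_skewGen, skew_complete, Polynomial.finsetSum_coeff]
  simp only [Polynomial.coeff_monomial]
  rw [Finset.sum_ite_eq']
  split_ifs with hi
  · rfl
  · rw [Finset.mem_range] at hi
    rw [complete_of_neg (by omega), smul_zero]

/-- On $\sum_n h_nz^n$ the substitution is multiplication by $(1-uz)/(1-tuz)$; the identity is the
coefficient of $z^n$ after clearing the denominator. -/
theorem skewGen_complete_sub (n : ℤ) :
    skewGen (complete n) - t • (Polynomial.X * skewGen (complete (n - 1))) =
      Polynomial.C (complete n) - Polynomial.X * Polynomial.C (complete (n - 1)) := by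
  ext1 i
  rw [Polynomial.coeff_sub, Polynomial.coeff_sub, Polynomial.coeff_smul]
  rcases i with _ | _ | i
  · simp [coeff_skewGen, skew_zero]
  · rw [Polynomial.coeff_X_mul, Polynomial.coeff_X_mul, coeff_skewGen, coeff_skewGen,
      skew_complete, skew_complete]
    simp [raisingCoeff, Polynomial.coeff_C, sub_smul]
  · rw [Polynomial.coeff_X_mul, Polynomial.coeff_X_mul, coeff_skewGen, coeff_skewGen,
      skew_complete, skew_complete, smul_smul,
      show n - 1 - ((i + 1 : ℕ) : ℤ) = n - ((i + 1 + 1 : ℕ) : ℤ) by push_cast; ring, ← sub_smul]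
    simp only [raisingCoeff, Polynomial.coeff_C, if_neg (Nat.succ_ne_zero _), Nat.add_sub_cancel,
      sub_self]
    rw [show t ^ (i + 1 + 1) - t ^ (i + 1) - t * (t ^ (i + 1) - t ^ i) = 0 by ring, zero_smul]

/-- The linear map `u ^ i ↦ s_{i + r}`. -/
def vertexSum (r : ℤ) : Polynomial Sym →ₗ[Sym] Sym :=
  Polynomial.lsum fun i => LinearMap.toSpanSingleton Sym Sym (complete (i + r))

theorem vertexSum_monomial (r : ℤ) (i : ℕ) (a : Sym) :
    vertexSum r (Polynomial.monomial i a) = a * complete (i + r) := by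
  simp [vertexSum, Polynomial.lsum_apply, Polynomial.sum_monomial_index]

theorem vertexSum_eq_sum (r : ℤ) (P : Polynomial Sym) {N : ℕ} (h : P.natDegree < N) :
    vertexSum r P = ∑ i ∈ Finset.range N, complete (i + r) * P.coeff i := by
  conv_lhs => rw [P.as_sum_range' N h]
  rw [map_sum]
  exact Finset.sum_congr rfl fun i _ => by rw [vertexSum_monomial, mul_comm]

theorem vertexSum_X_mul (r : ℤ) (P : Polynomial Sym) :
    vertexSum r (Polynomial.X * P) = vertexSum (r + 1) P := by
  induction P using Polynomial.induction_on' with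
  | add p q hp hq => rw [mul_add, map_add, map_add, hp, hq]
  | monomial i a =>
    rw [Polynomial.X_mul_monomial, vertexSum_monomial, vertexSum_monomial]
    congr 2
    push_cast
    ring

theorem vertexB_eq (r : ℤ) (f : Sym) : vertexB r f = vertexSum r (skewGen f) := by
  rw [vertexSum_eq_sum r _ (Nat.lt_succ_self _), vertexB]
  rw [finsum_eq_sum_of_support_subset]
  · exact Finset.sum_congr rfl fun i _ => by rw [coeff_skewGen]; rfl
  · intro i hi
    by_contra hN
    simp only [Finset.coe_range, Set.mem_Iio, not_lt] at hN
    refine hi ?_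
    change _ * skew i f = 0
    rw [← coeff_skewGen, Polynomial.coeff_eq_zero_of_natDegree_lt hN, mul_zero]

/-- The operator `B_r` as a linear map. -/
def vertexLin (r : ℤ) : Sym →ₗ[Scalar] Sym :=
  ((vertexSum r).restrictScalars Scalar).comp skewGen.toLinearMap

theorem vertexB_eq_vertexLin (r : ℤ) (f : Sym) : vertexB r f = vertexLin r f := vertexB_eq r f

theorem vertexB_add (r : ℤ) (f g : Sym) : vertexB r (f + g) = vertexB r f + vertexB r g := by
  simp only [vertexB_eq_vertexLin, map_add]

theorem vertexB_smul (r : ℤ) (c : Scalar) (f : Sym) : vertexB r (c • f) = c • vertexB r f := by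
  simp only [vertexB_eq_vertexLin, map_smul]

theorem vertexB_complete_mul (m s : ℤ) (f : Sym) :
    vertexB m (complete s * f) - t • vertexB (m + 1) (complete (s - 1) * f) =
      complete s * vertexB m f - complete (s - 1) * vertexB (m + 1) f := by
  have hs : ∀ (c : Scalar) (P : Polynomial Sym), vertexSum m (c • P) = c • vertexSum m P :=
    fun c P => ((vertexSum m).restrictScalars Scalar).map_smul c P
  simp only [vertexB_eq, map_mul]
  rw [← vertexSum_X_mul, ← vertexSum_X_mul, ← hs, ← map_sub, ← mul_assoc, ← smul_mul_assoc,
    ← sub_mul, skewGen_complete_sub, sub_mul, map_sub, ← Polynomial.smul_eq_C_mul, map_smul,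
    smul_eq_mul, mul_comm Polynomial.X, mul_assoc, ← Polynomial.smul_eq_C_mul, map_smul,
    smul_eq_mul]

theorem vertexB_eq_sum (r : ℤ) (f : Sym) {N : ℕ} (h : (skewGen f).natDegree < N) :
    vertexB r f = ∑ i ∈ Finset.range N, complete (i + r) * skew i f := by
  rw [vertexB_eq, vertexSum_eq_sum r _ h]
  exact Finset.sum_congr rfl fun i _ => by rw [coeff_skewGen]

/-- The combination on the left removes the skewings of the inner $h$'s. What remains is a double
sum whose bracket changes sign under $(m,n,i,j)\mapsto(n-1,m+1,j,i)$, which is how the commutation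
relation arises. -/
theorem vertexB_comp_sub (m n : ℤ) (f : Sym) {N : ℕ} (h : (skewGen f).natDegree < N) :
    vertexB m (vertexB n f) - t • vertexB (m + 1) (vertexB (n - 1) f) =
      ∑ j ∈ Finset.range N, ∑ i ∈ Finset.range N,
        (complete (j + n) * complete (i + m) -
          complete (j + (n - 1)) * complete (i + (m + 1))) * skew i (skew j f) := by
  have hB : ∀ (r : ℤ) (j : ℕ), vertexB r (skew j f) =
      ∑ i ∈ Finset.range N, complete (i + r) * skew i (skew j f) := by
    intro r j
    -- The cutoff for $f$ also serves every skewing of $f$, because skewings commute.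
    refine vertexB_eq_sum r _ (lt_of_le_of_lt (Polynomial.natDegree_le_iff_coeff_eq_zero.mpr ?_) h)
    intro i hi
    rw [coeff_skewGen, skew_comm, ← coeff_skewGen f i,
      Polynomial.coeff_eq_zero_of_natDegree_lt hi, skew_zero_right]
  rw [vertexB_eq_sum n f h, vertexB_eq_sum (n - 1) f h]
  simp only [vertexB_eq_vertexLin, map_sum]
  simp only [← vertexB_eq_vertexLin]
  rw [Finset.smul_sum, ← Finset.sum_sub_distrib]
  refine Finset.sum_congr rfl fun j _ => ?_
  rw [show (j : ℤ) + (n - 1) = j + n - 1 by ring, vertexB_complete_mul, hB, hB, Finset.mul_sum,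
    Finset.mul_sum, ← Finset.sum_sub_distrib]
  exact Finset.sum_congr rfl fun i _ => by ring

/-- The commutation relation of the operators `B_m` and `B_n`. -/
theorem vertexB_comm (m n : ℤ) (f : Sym) :
    vertexB m (vertexB n f) = t • vertexB (m + 1) (vertexB (n - 1) f) +
      t • vertexB n (vertexB m f) - vertexB (n - 1) (vertexB (m + 1) f) := by
  have h1 := vertexB_comp_sub m n f (Nat.lt_succ_self _)
  have h2 := vertexB_comp_sub (n - 1) (m + 1) f (Nat.lt_succ_self _)
  rw [sub_add_cancel, add_sub_cancel_right, Finset.sum_comm] at h2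
  have h3 := congrArg₂ (· + ·) h1 h2
  simp only [← Finset.sum_add_distrib] at h3
  rw [Finset.sum_eq_zero] at h3
  · linear_combination h3
  · intro i _
    refine Finset.sum_eq_zero fun j _ => ?_
    rw [skew_comm j i]
    ring

/-- For $n=m+1$ the relation contains the left side twice and the right side twice, so a factor 2 is
cancelled. This case is separate because the last term of the general relation would reproduce the
word itself. -/
theorem vertexB_succ (m : ℤ) (f : Sym) :
    vertexB m (vertexB (m + 1) f) = t • vertexB (m + 1) (vertexB m f) := by
  have h := vertexB_comm m (m + 1) f
  rw [add_sub_cancel_right, eq_sub_iff_add_eq, ← two_nsmul, ← two_nsmul] at h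
  exact (nsmul_right_injective two_ne_zero) h

theorem vertexB_one (r : ℤ) : vertexB r 1 = complete r := by
  rw [vertexB_eq, map_one, ← Polynomial.monomial_zero_one, vertexSum_monomial]
  simp

theorem vertexB_zero_right (r : ℤ) : vertexB r 0 = 0 := by
  rw [vertexB_eq_vertexLin, map_zero]

/-- The composition `B_{α_1} B_{α_2} ⋯` applied to `f`. -/
abbrev vertexWord (α : List ℤ) (f : Sym) : Sym := α.foldr vertexB f

theorem vertexWord_add (α : List ℤ) (f g : Sym) :
    vertexWord α (f + g) = vertexWord α f + vertexWord α g := by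
  induction α with
  | nil => rfl
  | cons a α ih =>
    simp only [vertexWord, List.foldr_cons] at ih ⊢
    rw [ih, vertexB_add]

theorem vertexWord_smul (α : List ℤ) (c : Scalar) (f : Sym) :
    vertexWord α (c • f) = c • vertexWord α f := by
  induction α with
  | nil => rfl
  | cons a α ih =>
    simp only [vertexWord, List.foldr_cons] at ih ⊢
    rw [ih, vertexB_smul]

theorem vertexWord_append (α β : List ℤ) (f : Sym) :
    vertexWord (α ++ β) f = vertexWord α (vertexWord β f) := List.foldr_append

/-! ### Raising operators -/

theorem sum_mul_raise {m : ℕ} (w : Fin m → ℤ) (n : IndexPair m → ℕ) :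
    ∑ i, w i * raise n i = ∑ p, (n p : ℤ) * (w p.1.1 - w p.1.2) := by
  classical
  simp only [raise, Finset.sum_apply, Finset.mul_sum]
  rw [Finset.sum_comm]
  refine Finset.sum_congr rfl fun p _ => ?_
  have : ∀ i, w i * ((n p : ℤ) • (Pi.single p.1.1 1 - Pi.single p.1.2 1) : Fin m → ℤ) i =
      n p * (w i * (Pi.single p.1.1 1 : Fin m → ℤ) i - w i * (Pi.single p.1.2 1 : Fin m → ℤ) i) := by
    intro i
    simp only [Pi.smul_apply, Pi.sub_apply, smul_eq_mul]
    ring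
  simp only [this]
  rw [← Finset.mul_sum, Finset.sum_sub_distrib]
  simp [Pi.single_apply]

theorem raise_apply {m : ℕ} (n : IndexPair m → ℕ) (i : Fin m) :
    raise n i = ∑ p : IndexPair m,
      (n p : ℤ) * ((if p.1.1 = i then 1 else 0) - if p.1.2 = i then 1 else 0) := by
  have := sum_mul_raise (fun j => if j = i then 1 else 0) n
  simpa using this

/-- Every application of $R_{ij}$ lowers $\sum_i i\alpha_i$ by $j-i\ge1$, and this sum stays
nonnegative as long as the entries do. The bound makes the raising-operator series finite. -/
theorem le_of_raise_nonneg {m : ℕ} (α : Fin m → ℤ) (n : IndexPair m → ℕ)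
    (h : ∀ i, 0 ≤ α i + raise n i) (p : IndexPair m) : (n p : ℤ) ≤ ∑ i : Fin m, (i : ℤ) * α i := by
  have h1 : 0 ≤ ∑ i : Fin m, (i : ℤ) * (α i + raise n i) :=
    Finset.sum_nonneg fun i _ => mul_nonneg (by positivity) (h i)
  simp only [mul_add, Finset.sum_add_distrib] at h1
  rw [sum_mul_raise] at h1
  have h2 : ∑ p : IndexPair m, (n p : ℤ) ≤
      -∑ p : IndexPair m, (n p : ℤ) * ((p.1.1 : ℕ) - (p.1.2 : ℕ) : ℤ) := by
    rw [← Finset.sum_neg_distrib]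
    refine Finset.sum_le_sum fun p _ => ?_
    have : (p.1.1 : ℕ) < (p.1.2 : ℕ) := p.2
    nlinarith [Int.natCast_nonneg (n p)]
  have h3 := Finset.single_le_sum (f := fun p : IndexPair m => (n p : ℤ))
    (fun p _ => Int.natCast_nonneg _) (Finset.mem_univ p)
  linarith

theorem finite_raise_nonneg {m : ℕ} (α : Fin m → ℤ) :
    {n : IndexPair m → ℕ | ∀ i, 0 ≤ α i + raise n i}.Finite := by
  refine (Set.finite_Iic fun _ : IndexPair m => (∑ i : Fin m, (i : ℤ) * α i).toNat).subset fun n hn p => ?_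
  have := le_of_raise_nonneg α n hn p
  change n p ≤ (∑ i : Fin m, (i : ℤ) * α i).toNat
  omega

/-- The term of `n` in the expansion of `∏_{i < j} (1 - R_{ij}) / (1 - t R_{ij}) h_α`. -/
def raisedTerm {m : ℕ} (α : Fin m → ℤ) (n : IndexPair m → ℕ) : Sym :=
  (∏ p, raisingCoeff (n p)) • ∏ i, complete (α i + raise n i)

theorem support_raisedTerm_subset {m : ℕ} (α : Fin m → ℤ) :
    Function.support (raisedTerm α) ⊆ {n | ∀ i, 0 ≤ α i + raise n i} := by
  intro n hn i
  by_contra hi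
  refine hn ?_
  rw [raisedTerm, Finset.prod_eq_zero (Finset.mem_univ i) (complete_of_neg (not_le.mp hi)),
    smul_zero]

theorem finite_support_raisedTerm {m : ℕ} (α : Fin m → ℤ) :
    (Function.support (raisedTerm α)).Finite :=
  (finite_raise_nonneg α).subset (support_raisedTerm_subset α)

theorem one_sub_t_pow_ne_zero (n : ℕ+) : 1 - t ^ (n : ℕ) ≠ 0 := by
  intro h
  have h1 : (algebraMap (Polynomial ℚ) Scalar) (Polynomial.X ^ (n : ℕ)) =
      algebraMap (Polynomial ℚ) Scalar 1 := by
    rw [map_pow, RatFunc.algebraMap_X, map_one]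
    exact (sub_eq_zero.mp h).symm
  have h2 := RatFunc.algebraMap_injective ℚ h1
  have h3 := congrArg Polynomial.natDegree h2
  rw [Polynomial.natDegree_X_pow, Polynomial.natDegree_one] at h3
  exact n.ne_zero h3

theorem divOneSubT_timesOneSubT (f : Sym) : divOneSubT (timesOneSubT f) = f := by
  suffices h : divOneSubT.comp timesOneSubT = AlgHom.id Scalar Sym from DFunLike.congr_fun h f
  ext1 n
  simp [divOneSubT, timesOneSubT, scaleAlphabet, powerSum, smul_smul,
    mul_inv_cancel₀ (one_sub_t_pow_ne_zero n)]

/-- The substitution $X/(1-t)$ turns $q_r$ back into $h_r$, so $H_\lambda$ is the same series in the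
$h$'s. -/
theorem hallLittlewoodH_eq_finsum (l : List ℕ) :
    hallLittlewoodH l = ∑ᶠ n, raisedTerm (fun i : Fin l.length => (l.get i : ℤ)) n := by
  have hterm : ∀ n : IndexPair l.length → ℕ, (∏ p, raisingCoeff (n p)) •
      ∏ i : Fin l.length, timesOneSubT (complete ((l.get i : ℤ) + raise n i)) =
      timesOneSubT (raisedTerm (fun i : Fin l.length => (l.get i : ℤ)) n) := by
    intro n
    rw [raisedTerm, map_smul, map_prod]
  rw [hallLittlewoodH, hallLittlewoodQ, finsum_congr hterm]
  have := AddMonoidHom.map_finsum timesOneSubT.toRingHom.toAddMonoidHom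
    (finite_support_raisedTerm (fun i : Fin l.length => (l.get i : ℤ)))
  exact (congrArg divOneSubT this).symm.trans (divOneSubT_timesOneSubT _)

/-! ### Hall-Littlewood functions from vertex operators -/

/-- The pairs in `{0, …, m}` are the pairs `(0, i + 1)` and the shifts of the pairs in
`{0, …, m - 1}`. -/
def indexPairSucc (m : ℕ) : Fin m ⊕ IndexPair m ≃ IndexPair (m + 1) where
  toFun := Sum.elim (fun i => ⟨(0, i.succ), i.succ_pos⟩)
    fun p => ⟨(p.1.1.succ, p.1.2.succ), Fin.succ_lt_succ_iff.mpr p.2⟩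
  invFun p := if h : p.1.1 = 0 then
      Sum.inl (p.1.2.pred (Fin.ne_zero_of_lt p.2))
    else Sum.inr ⟨(p.1.1.pred h, p.1.2.pred (Fin.ne_zero_of_lt p.2)),
      (Fin.pred_lt_pred_iff (ha := h) (hb := Fin.ne_zero_of_lt p.2)).mpr p.2⟩
  left_inv x := by
    rcases x with i | p <;> simp
  right_inv p := by
    obtain ⟨⟨a, b⟩, h⟩ := p
    by_cases ha : a = 0
    · subst ha; simp
    · simp [ha]

/-- Exponents on the pairs in `{0, …, m}` as exponents on the shifted pairs and on the pairs
`(0, i + 1)`. -/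
def exponentSucc (m : ℕ) :
    (IndexPair m → ℕ) × (Fin m → ℕ) ≃ (IndexPair (m + 1) → ℕ) :=
  (Equiv.prodComm _ _).trans ((Equiv.sumArrowEquivProdArrow _ _ _).symm.trans
    ((indexPairSucc m).arrowCongr (Equiv.refl ℕ)))

theorem exponentSucc_inl (m : ℕ) (x : (IndexPair m → ℕ) × (Fin m → ℕ)) (i : Fin m) :
    exponentSucc m x (indexPairSucc m (Sum.inl i)) = x.2 i := by
  simp [exponentSucc, Equiv.arrowCongr, Equiv.sumArrowEquivProdArrow]

theorem exponentSucc_inr (m : ℕ) (x : (IndexPair m → ℕ) × (Fin m → ℕ)) (p : IndexPair m) :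
    exponentSucc m x (indexPairSucc m (Sum.inr p)) = x.1 p := by
  simp [exponentSucc, Equiv.arrowCongr, Equiv.sumArrowEquivProdArrow]

theorem raise_exponentSucc_zero (m : ℕ) (x : (IndexPair m → ℕ) × (Fin m → ℕ)) :
    raise (exponentSucc m x) 0 = ∑ i, (x.2 i : ℤ) := by
  rw [raise_apply, ← (indexPairSucc m).sum_comp, Fintype.sum_sum_type]
  simp only [exponentSucc_inl, exponentSucc_inr]
  simp [indexPairSucc]

theorem raise_exponentSucc_succ (m : ℕ) (x : (IndexPair m → ℕ) × (Fin m → ℕ)) (j : Fin m) :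
    raise (exponentSucc m x) j.succ = raise x.1 j - x.2 j := by
  rw [raise_apply, ← (indexPairSucc m).sum_comp, Fintype.sum_sum_type]
  simp only [exponentSucc_inl, exponentSucc_inr, raise_apply x.1]
  simp [indexPairSucc, (Fin.succ_ne_zero j).symm]
  ring

theorem raisedTerm_cons {m : ℕ} (a : ℤ) (α : Fin m → ℤ)
    (x : (IndexPair m → ℕ) × (Fin m → ℕ)) :
    raisedTerm (Fin.cons a α : Fin (m + 1) → ℤ) (exponentSucc m x) =
      (∏ p, raisingCoeff (x.1 p)) • (∏ i, raisingCoeff (x.2 i)) •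
        (complete (a + ∑ i, (x.2 i : ℤ)) * ∏ i, complete (α i + raise x.1 i - x.2 i)) := by
  rw [raisedTerm, ← (indexPairSucc m).prod_comp, Fintype.prod_sum_type, Fin.prod_univ_succ]
  simp only [exponentSucc_inl, exponentSucc_inr, raise_exponentSucc_zero,
    raise_exponentSucc_succ, Fin.cons_zero, Fin.cons_succ]
  rw [smul_smul, mul_comm (∏ p, raisingCoeff (x.1 p))]
  simp only [add_sub_assoc]

/-- By multiplicativity each factor is skewed on its own; $b_i$ is the power of $u$ taken from
factor $i$, and the total power raises $a$. Thus $b_i$ is the exponent of the raising operator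
joining the new index to index $i$. -/
theorem vertexB_prod_complete {m : ℕ} (a : ℤ) (β : Fin m → ℤ) :
    vertexB a (∏ i, complete (β i)) = ∑ᶠ b : Fin m → ℕ, (∏ i, raisingCoeff (b i)) •
      (complete (a + ∑ i, (b i : ℤ)) * ∏ i, complete (β i - b i)) := by
  classical
  obtain ⟨N, hN⟩ : ∃ N : ℕ, ∀ i, β i < N := by
    refine ⟨∑ i, (β i).toNat + 1, fun i => ?_⟩
    have := Finset.single_le_sum (f := fun i => (β i).toNat) (fun _ _ => Nat.zero_le _)
      (Finset.mem_univ i)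
    have h2 := Int.self_le_toNat (β i)
    have h3 : ((β i).toNat : ℤ) ≤ (∑ i, (β i).toNat : ℕ) := Int.ofNat_le.mpr this
    omega
  have hsupp : Function.support (fun b : Fin m → ℕ => (∏ i, raisingCoeff (b i)) •
      (complete (a + ∑ i, (b i : ℤ)) * ∏ i, complete (β i - b i))) ⊆
      (Fintype.piFinset fun _ : Fin m => Finset.range N : Finset (Fin m → ℕ)) := by
    intro b hb
    rw [Finset.mem_coe, Fintype.mem_piFinset]
    intro i
    rw [Finset.mem_range]
    by_contra hi
    refine hb ?_
    have : complete (β i - b i) = 0 := complete_of_neg (by have := hN i; omega)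
    have h0 : ∏ i, complete (β i - b i) = 0 := Finset.prod_eq_zero (Finset.mem_univ i) this
    simp only [h0]
    rw [ mul_zero, smul_zero]
  rw [finsum_eq_sum_of_support_subset _ hsupp, vertexB_eq, map_prod,
    Finset.prod_congr rfl fun i _ => skewGen_complete (β i) N (hN i), Finset.prod_univ_sum, map_sum]
  refine Finset.sum_congr rfl fun b _ => ?_
  have hmon : ∀ (s : Finset (Fin m)) (c : Fin m → Sym),
      ∏ i ∈ s, Polynomial.monomial (b i) (c i) =
        Polynomial.monomial (∑ i ∈ s, b i) (∏ i ∈ s, c i) := by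
    intro s c
    induction s using Finset.induction_on with
    | empty => simp
    | insert i s hi ih =>
      rw [Finset.prod_insert hi, Finset.prod_insert hi, Finset.sum_insert hi, ih,
        Polynomial.monomial_mul_monomial]
  rw [hmon, vertexSum_monomial, Finset.prod_smul, smul_mul_assoc, mul_comm]
  push_cast
  rw [add_comm]

theorem finsum_raisedTerm_cons {m : ℕ} (a : ℤ) (α : Fin m → ℤ) :
    ∑ᶠ n, raisedTerm (Fin.cons a α : Fin (m + 1) → ℤ) n = vertexB a (∑ᶠ n, raisedTerm α n) := by
  have h1 := AddMonoidHom.map_finsum (vertexLin a).toAddMonoidHom (finite_support_raisedTerm α)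
  have h1' : vertexB a (∑ᶠ n, raisedTerm α n) = ∑ᶠ n, vertexB a (raisedTerm α n) := by
    simp only [vertexB_eq_vertexLin]
    exact h1
  rw [h1', ← finsum_comp_equiv (exponentSucc m), finsum_curry]
  · refine finsum_congr fun n => ?_
    rw [raisedTerm, vertexB_smul, vertexB_prod_complete, smul_finsum]
    exact finsum_congr fun b => raisedTerm_cons a α (n, b)
  · refine Set.Finite.of_injOn (f := exponentSucc m)
      (t := Function.support (raisedTerm (Fin.cons a α : Fin (m + 1) → ℤ))) (fun x hx => hx)
      (exponentSucc m).injective.injOn (finite_support_raisedTerm _)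

/-- `H_λ[X;t] = B_{λ_1} B_{λ_2} ⋯ 1`. -/
theorem hallLittlewoodH_eq_vertexWord (l : List ℕ) :
    hallLittlewoodH l = vertexWord (l.map Nat.cast) 1 := by
  rw [hallLittlewoodH_eq_finsum]
  induction l with
  | nil =>
    rw [finsum_eq_single _ (fun _ => 0)]
    · simp [raisedTerm, vertexWord]
    · intro n hn
      exact absurd (funext fun p => p.1.1.elim0) hn
  | cons a l ih =>
    have : (fun i : Fin (a :: l).length => (((a :: l).get i : ℕ) : ℤ)) =
        (Fin.cons (a : ℤ) fun i : Fin l.length => (l.get i : ℤ)) := by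
      funext i
      refine Fin.cases ?_ (fun j => ?_) i <;> rfl
    rw [this]
    change ∑ᶠ n, raisedTerm (Fin.cons (a : ℤ) fun i : Fin l.length => (l.get i : ℤ) :
      Fin (l.length + 1) → ℤ) n = _
    rw [finsum_raisedTerm_cons, ih]
    rfl

/-! ### Expansions in Hall-Littlewood functions -/

/-- The combination of the functions `H_μ` with the given polynomials in `t` as coefficients. -/
def combination (k : ℕ) : (BoundedPartition k →₀ Polynomial ℤ) →+ Sym :=
  Finsupp.liftAddHom fun m =>
    ((smulAddHom Scalar Sym).flip (hallLittlewoodH m.1)).comp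
      (Polynomial.aeval t : Polynomial ℤ →ₐ[ℤ] Scalar).toRingHom.toAddMonoidHom

theorem combination_apply (k : ℕ) (g : BoundedPartition k →₀ Polynomial ℤ) :
    combination k g = ∑ m ∈ g.support, Polynomial.aeval t (g m) • hallLittlewoodH m.1 := rfl

theorem combination_smul (k : ℕ) (p : Polynomial ℤ) (g : BoundedPartition k →₀ Polynomial ℤ) :
    combination k (p • g) = Polynomial.aeval t p • combination k g := by
  induction g using Finsupp.induction_linear with
  | zero => simp
  | add f g hf hg => rw [smul_add, map_add, map_add, smul_add, hf, hg]
  | single m q =>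
    rw [Finsupp.smul_single, smul_eq_mul]
    simp only [combination, Finsupp.liftAddHom_apply_single]
    simp [mul_smul]

/-- `f` is a combination of the functions `H_μ` for `k`-bounded partitions `μ` which satisfy `S`,
with coefficients in `ℤ[t]`. -/
def HasExpansion {k : ℕ} (S : BoundedPartition k → Prop) (f : Sym) : Prop :=
  ∃ g : BoundedPartition k →₀ Polynomial ℤ, (∀ m ∈ g.support, S m) ∧ f = combination k g

namespace HasExpansion

variable {k : ℕ} {S S' : BoundedPartition k → Prop} {f f' : Sym}

theorem zero : HasExpansion S 0 := ⟨0, by simp, by simp⟩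

theorem add (h : HasExpansion S f) (h' : HasExpansion S f') : HasExpansion S (f + f') := by
  classical
  obtain ⟨g, hg, rfl⟩ := h
  obtain ⟨g', hg', rfl⟩ := h'
  refine ⟨g + g', fun m hm => ?_, (map_add _ _ _).symm⟩
  rcases Finset.mem_union.mp (Finsupp.support_add hm) with h | h
  exacts [hg m h, hg' m h]

theorem smul (p : Polynomial ℤ) (h : HasExpansion S f) :
    HasExpansion S (Polynomial.aeval t p • f) := by
  obtain ⟨g, hg, rfl⟩ := h
  exact ⟨p • g, fun m hm => hg m (Finsupp.support_smul hm), (combination_smul k p g).symm⟩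

theorem t_smul (h : HasExpansion S f) : HasExpansion S (t • f) := by
  simpa using h.smul Polynomial.X

theorem neg (h : HasExpansion S f) : HasExpansion S (-f) := by
  simpa using h.smul (-1)

theorem neg_t_pow_smul (h : HasExpansion S f) (n : ℕ) : HasExpansion S ((-t) ^ n • f) := by
  simpa using h.smul ((-Polynomial.X) ^ n)

theorem sum {ι : Type*} {s : Finset ι} {f : ι → Sym} (h : ∀ i ∈ s, HasExpansion S (f i)) :
    HasExpansion S (∑ i ∈ s, f i) :=
  Finset.sum_induction f (HasExpansion S) (fun _ _ => add) zero h

theorem mono (h : HasExpansion S f) (hS : ∀ m, S m → S' m) : HasExpansion S' f := by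
  obtain ⟨g, hg, rfl⟩ := h
  exact ⟨g, fun m hm => hS m (hg m hm), rfl⟩

theorem of_mem (m : BoundedPartition k) (hm : S m) : HasExpansion S (hallLittlewoodH m.1) := by
  classical
  refine ⟨Finsupp.single m 1, fun m' hm' => ?_, by simp [combination]⟩
  rw [Finset.mem_singleton.mp (Finsupp.support_single_subset hm')]
  exact hm

theorem vertexWord (α : List ℤ) (h : HasExpansion S f)
    (hS : ∀ m, S m → HasExpansion S' (KSplit.vertexWord α (hallLittlewoodH m.1))) :
    HasExpansion S' (KSplit.vertexWord α f) := by
  obtain ⟨g, hg, rfl⟩ := h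
  let F : Sym →ₗ[Scalar] Sym :=
    { toFun := KSplit.vertexWord α
      map_add' := vertexWord_add α
      map_smul' := fun c f => vertexWord_smul α c f }
  change HasExpansion S' (F _)
  rw [combination_apply, map_sum]
  refine sum fun m hm => ?_
  rw [map_smul]
  exact (hS m (hg m hm)).smul _

end HasExpansion

/-! ### Dominance of integer sequences -/

/-- The weak dominance order on integer sequences. -/
def DominanceLE (α β : List ℤ) : Prop :=
  α.sum = β.sum ∧ ∀ i : ℕ, (α.take i).sum ≤ (β.take i).sum

theorem DominanceLE.refl (α : List ℤ) : DominanceLE α α := ⟨rfl, fun _ => le_rfl⟩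

theorem DominanceLE.trans {α β γ : List ℤ} (h : DominanceLE α β) (h' : DominanceLE β γ) :
    DominanceLE α γ :=
  ⟨h.1.trans h'.1, fun i => (h.2 i).trans (h'.2 i)⟩

theorem dominanceLE_cons_iff (a : ℤ) (α β : List ℤ) :
    DominanceLE (a :: α) (a :: β) ↔ DominanceLE α β := by
  constructor
  · rintro ⟨h1, h2⟩
    refine ⟨by simpa using h1, fun i => ?_⟩
    simpa using h2 (i + 1)
  · rintro ⟨h1, h2⟩
    refine ⟨by simpa using h1, fun i => ?_⟩
    rcases i with _ | i
    · simp
    · simpa using h2 i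

theorem dominanceLE_append_iff (γ α β : List ℤ) :
    DominanceLE (γ ++ α) (γ ++ β) ↔ DominanceLE α β := by
  induction γ with
  | nil => rfl
  | cons a γ ih => rw [List.cons_append, List.cons_append, dominanceLE_cons_iff, ih]

theorem dominanceLE_adjacent (γ δ : List ℤ) {m n m' n' : ℤ} (h : m ≤ m') (h' : m + n = m' + n') :
    DominanceLE (γ ++ m :: n :: δ) (γ ++ m' :: n' :: δ) := by
  rw [dominanceLE_append_iff]
  refine ⟨by simp only [List.sum_cons]; omega, fun i => ?_⟩
  rcases i with _ | _ | i
  · simp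
  · simpa using h
  · simp only [List.take_succ_cons, List.sum_cons]; omega

theorem dominanceLE_append_right {α β : List ℤ} (γ : List ℤ) (h : DominanceLE α β)
    (hl : α.length = β.length) : DominanceLE (α ++ γ) (β ++ γ) := by
  refine ⟨by rw [List.sum_append, List.sum_append, h.1], fun i => ?_⟩
  rw [List.take_append, List.take_append, List.sum_append, List.sum_append, hl]
  exact Int.add_le_add_right (h.2 i) _

/-- Positivity excludes trailing zeros, which partial sums cannot detect. -/
theorem eq_of_sum_take_eq {l m : List ℕ} (hl : ∀ x ∈ l, 0 < x) (hm : ∀ x ∈ m, 0 < x)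
    (h : ∀ i, (l.take i).sum = (m.take i).sum) : l = m := by
  induction l generalizing m with
  | nil =>
    rcases m with _ | ⟨b, m⟩
    · rfl
    · have := h 1
      have := hm b (by simp)
      simp_all
  | cons a l ih =>
    rcases m with _ | ⟨b, m⟩
    · have := h 1
      have := hl a (by simp)
      simp_all
    · have h1 : a = b := by simpa using h 1
      subst h1
      rw [ih (fun x hx => hl x (List.mem_cons_of_mem _ hx))
        (fun x hx => hm x (List.mem_cons_of_mem _ hx)) fun i => ?_]
      simpa using h (i + 1)

theorem dominanceLE_map_cast (l m : List ℕ) :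
    DominanceLE (l.map Nat.cast) (m.map Nat.cast) ↔
      l.sum = m.sum ∧ ∀ i : ℕ, (l.take i).sum ≤ (m.take i).sum := by
  unfold DominanceLE
  simp only [← List.map_take]
  have : ∀ u : List ℕ, (u.map (Nat.cast : ℕ → ℤ)).sum = (u.sum : ℕ) :=
    fun u => (Nat.cast_list_sum u).symm
  simp only [this]
  norm_cast

theorem dominanceLT_iff (l m : List ℕ) :
    DominanceLT l m ↔ l ≠ m ∧ DominanceLE (l.map Nat.cast) (m.map Nat.cast) := by
  rw [dominanceLE_map_cast]
  rfl

theorem eq_of_dominanceLE {l m : List ℕ} (hl : ∀ x ∈ l, 0 < x) (hm : ∀ x ∈ m, 0 < x)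
    (h : DominanceLE (l.map Nat.cast) (m.map Nat.cast))
    (h' : DominanceLE (m.map Nat.cast) (l.map Nat.cast)) : l = m := by
  rw [dominanceLE_map_cast] at h h'
  exact eq_of_sum_take_eq hl hm fun i => le_antisymm (h.2 i) (h'.2 i)

/-! ### Straightening -/

theorem pairwise_or_exists_lt (α : List ℤ) :
    α.Pairwise (· ≥ ·) ∨ ∃ γ m n δ, α = γ ++ m :: n :: δ ∧ m < n := by
  induction α with
  | nil => exact Or.inl List.Pairwise.nil
  | cons a l ih =>
    rcases ih with h | ⟨γ, m, n, δ, rfl, h⟩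
    · rcases l with _ | ⟨b, l⟩
      · exact Or.inl (List.pairwise_singleton _ _)
      · rcases lt_or_ge a b with hab | hab
        · exact Or.inr ⟨[], a, b, l, rfl, hab⟩
        · refine Or.inl (List.pairwise_cons.mpr ⟨fun x hx => ?_, h⟩)
          rcases List.mem_cons.mp hx with rfl | hx
          · exact hab
          · exact ((List.pairwise_cons.mp h).1 x hx).trans hab
    · exact Or.inr ⟨a :: γ, m, n, δ, rfl, h⟩

/-- Since $B_r1=h_r$, a negative last entry kills the word, while trailing zeros can be dropped
without changing partial sums. -/
theorem vertexWord_of_pairwise (α : List ℤ) (h : α.Pairwise (· ≥ ·)) :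
    vertexWord α 1 = 0 ∨ ∃ μ : List ℕ, IsPartition μ ∧
      vertexWord α 1 = hallLittlewoodH μ ∧ DominanceLE α (μ.map Nat.cast) ∧
        ∀ x ∈ μ, (x : ℤ) ∈ α := by
  induction α with
  | nil =>
    refine Or.inr ⟨[], ⟨List.Pairwise.nil.sortedGE, by simp⟩, ?_, DominanceLE.refl _, by simp⟩
    rw [hallLittlewoodH_eq_vertexWord]
    rfl
  | cons a l ih =>
    obtain ⟨hal, hl⟩ := List.pairwise_cons.mp h
    change vertexB a (vertexWord l 1) = 0 ∨ ∃ μ : List ℕ, IsPartition μ ∧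
      vertexB a (vertexWord l 1) = _ ∧ _
    rcases ih hl with h0 | ⟨μ, hμ, hV, hdom, hmem⟩
    · exact Or.inl (by rw [h0, vertexB_zero_right])
    rw [hV]
    rcases lt_or_ge 0 a with ha | ha
    · lift a to ℕ using ha.le
      refine Or.inr ⟨a :: μ, ⟨?_, ?_⟩, ?_, (dominanceLE_cons_iff _ _ _).mpr hdom, ?_⟩
      · refine (List.pairwise_cons.mpr ⟨fun x hx => ?_, hμ.1.pairwise⟩).sortedGE
        exact_mod_cast hal x (hmem x hx)
      · intro x hx
        rcases List.mem_cons.mp hx with rfl | hx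
        · exact_mod_cast ha
        · exact hμ.2 x hx
      · rw [hallLittlewoodH_eq_vertexWord, hallLittlewoodH_eq_vertexWord]
        rfl
      · intro x hx
        rcases List.mem_cons.mp hx with rfl | hx
        · simp
        · exact List.mem_cons_of_mem _ (hmem x hx)
    · obtain rfl : μ = [] := by
        refine List.eq_nil_iff_forall_not_mem.mpr fun x hx => ?_
        have h1 := hal x (hmem x hx)
        have h2 := hμ.2 x hx
        omega
      have h1 : hallLittlewoodH [] = 1 := by rw [hallLittlewoodH_eq_vertexWord]; rfl
      rw [h1, vertexB_one]
      rcases ha.lt_or_eq with ha | rfl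
      · exact Or.inl (complete_of_neg ha)
      · refine Or.inr ⟨[], hμ, by rw [complete_zero, h1], ⟨?_, fun i => ?_⟩, by simp⟩
        · simpa using hdom.1
        · rcases i with _ | i
          · simp
          · simpa using hdom.2 i

/-- A measure for the distance of an integer sequence with entries at most `k` from being weakly
decreasing. -/
def disorder (k : ℕ) : List ℤ → ℕ
  | [] => 0
  | a :: l => (l.length + 1) * (k - a).toNat + disorder k l

/-- The weights decrease by one from left to right, so shifting $m'-m$ to the left lowers the
measure by exactly that amount. The bound $k$ makes the truncations exact. -/
theorem disorder_adjacent_lt (k : ℕ) (γ δ : List ℤ) {m n m' n' : ℤ} (h : m < m')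
    (h' : m + n = m' + n') (hm : m' ≤ k) (hn : n' ≤ k) (hn' : n ≤ k) :
    disorder k (γ ++ m' :: n' :: δ) < disorder k (γ ++ m :: n :: δ) := by
  induction γ with
  | nil =>
    simp only [List.nil_append, disorder, List.length_cons]
    obtain ⟨x, hx⟩ := Int.eq_ofNat_of_zero_le (sub_nonneg.mpr (h.le.trans hm))
    obtain ⟨y, hy⟩ := Int.eq_ofNat_of_zero_le (sub_nonneg.mpr hn')
    obtain ⟨x', hx'⟩ := Int.eq_ofNat_of_zero_le (sub_nonneg.mpr hm)
    obtain ⟨y', hy'⟩ := Int.eq_ofNat_of_zero_le (sub_nonneg.mpr hn)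
    rw [hx, hy, hx', hy']
    simp only [Int.toNat_natCast]
    have h1 : x + y = x' + y' := by omega
    have h2 : x' < x := by omega
    nlinarith
  | cons a γ ih =>
    simp only [List.cons_append, disorder, List.length_append, List.length_cons]
    omega

theorem hasExpansion_vertexWord (k : ℕ) (α : List ℤ) (hα : ∀ x ∈ α, x ≤ k) :
    HasExpansion (fun μ : BoundedPartition k => DominanceLE α (μ.1.map Nat.cast))
      (vertexWord α 1) := by
  induction hd : disorder k α using Nat.strong_induction_on generalizing α with
  | _ d ih =>
    subst hd
    rcases pairwise_or_exists_lt α with h | ⟨γ, m, n, δ, rfl, h⟩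
    · rcases vertexWord_of_pairwise α h with h0 | ⟨μ, hμ, hV, hdom, hmem⟩
      · rw [h0]
        exact HasExpansion.zero
      · rw [hV]
        exact HasExpansion.of_mem ⟨μ, hμ, fun x hx => by exact_mod_cast hα _ (hmem x hx)⟩ hdom
    · have hm : m ≤ k := hα m (by simp)
      have hn : n ≤ k := hα n (by simp)
      have move : ∀ m' n' : ℤ, m < m' → m + n = m' + n' → m' ≤ k → n' ≤ k →
          HasExpansion (fun μ : BoundedPartition k =>
            DominanceLE (γ ++ m :: n :: δ) (μ.1.map Nat.cast))
            (vertexWord (γ ++ m' :: n' :: δ) 1) := by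
        intro m' n' h1 h2 h3 h4
        refine (ih _ (disorder_adjacent_lt k γ δ h1 h2 h3 h4 hn) _ (fun x hx => ?_) rfl).mono
          fun μ hμ => (dominanceLE_adjacent γ δ h1.le h2).trans hμ
        simp only [List.mem_append, List.mem_cons] at hx
        rcases hx with hx | rfl | rfl | hx
        · exact hα x (by simp [hx])
        · exact h3
        · exact h4
        · exact hα x (by simp [hx])
      have happ : ∀ a b : ℤ, vertexWord (γ ++ a :: b :: δ) 1 =
          vertexWord γ (vertexB a (vertexB b (vertexWord δ 1))) := fun a b => vertexWord_append _ _ _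
      -- If $n\ge m+2$, the new pairs start with $m+1$, $n$ and $n-1$, all larger than $m$.
      rcases (Int.add_one_le_iff.mpr h).lt_or_eq with h1 | rfl
      · rw [happ, vertexB_comm, sub_eq_add_neg, vertexWord_add, vertexWord_add, vertexWord_smul,
          vertexWord_smul, ← neg_one_smul Scalar, vertexWord_smul, neg_one_smul, ← happ, ← happ,
          ← happ]
        refine ((move _ _ ?_ ?_ ?_ ?_).t_smul.add (move _ _ ?_ ?_ ?_ ?_).t_smul).add
          (move _ _ ?_ ?_ ?_ ?_).neg <;> omega
      · rw [happ, vertexB_succ, vertexWord_smul, ← happ]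
        exact (move _ _ (by omega) (by omega) hn hm).t_smul

/-! ### The operators `B_λ` and the triangularity of the `k`-split polynomials -/

/-- The index vector which the raising operators in `E` produce from `l`. -/
def raisedIndex (l : List ℕ) (E : Finset (IndexPair l.length)) : List ℤ :=
  List.ofFn fun i : Fin l.length => (l.get i : ℤ) + raise (fun p => if p ∈ E then 1 else 0) i

theorem partitionB_eq (l : List ℕ) (f : Sym) :
    partitionB l f = ∑ E : Finset (IndexPair l.length),
      (-t) ^ E.card • vertexWord (raisedIndex l E) f := rfl

theorem length_raisedIndex (l : List ℕ) (E : Finset (IndexPair l.length)) :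
    (raisedIndex l E).length = l.length := List.length_ofFn

theorem raise_zero {m : ℕ} : raise (fun _ : IndexPair m => 0) = 0 := by
  simp [raise]

theorem ofFn_get_cast (l : List ℕ) :
    List.ofFn (fun i : Fin l.length => (l.get i : ℤ)) = l.map Nat.cast := by
  conv_rhs => rw [← List.ofFn_get l]
  rw [List.map_ofFn]
  rfl

theorem raisedIndex_empty (l : List ℕ) : raisedIndex l ∅ = l.map Nat.cast := by
  simp only [raisedIndex, Finset.notMem_empty, if_false]
  rw [raise_zero]
  simp only [Pi.zero_apply, add_zero]
  exact ofFn_get_cast l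

/-- Pairing the raising vector with the indicator of the first $j$ positions counts the pairs of $E$
separated by the cut at $j$. -/
theorem sum_take_raisedIndex (l : List ℕ) (E : Finset (IndexPair l.length)) (j : ℕ) :
    ((raisedIndex l E).take j).sum = ((l.map (Nat.cast : ℕ → ℤ)).take j).sum +
      ∑ p ∈ E, ((if (p.1.1 : ℕ) < j then 1 else 0) - if (p.1.2 : ℕ) < j then 1 else 0 : ℤ) := by
  classical
  rw [raisedIndex, ← ofFn_get_cast, List.sum_take_ofFn, List.sum_take_ofFn, Finset.sum_add_distrib]
  congr 1
  rw [Finset.sum_filter]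
  have := sum_mul_raise (fun i : Fin l.length => if (i : ℕ) < j then 1 else 0)
    (fun p : IndexPair l.length => if p ∈ E then 1 else 0)
  simp only [ite_mul, one_mul, zero_mul] at this
  rw [this]
  simp

theorem dominanceLE_raisedIndex (l : List ℕ) (E : Finset (IndexPair l.length)) :
    DominanceLE (l.map Nat.cast) (raisedIndex l E) := by
  refine ⟨?_, fun i => ?_⟩
  · have h := sum_take_raisedIndex l E l.length
    rw [List.take_of_length_le (by rw [length_raisedIndex]),
      List.take_of_length_le (by simp), Finset.sum_eq_zero (by simp), add_zero] at h
    exact h.symm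
  · rw [sum_take_raisedIndex]
    refine le_add_of_nonneg_right (Finset.sum_nonneg fun p _ => ?_)
    have : (p.1.1 : ℕ) < (p.1.2 : ℕ) := p.2
    split_ifs <;> omega

theorem exists_sum_take_lt_raisedIndex (l : List ℕ) {E : Finset (IndexPair l.length)}
    (hE : E.Nonempty) : ∃ i ≤ l.length,
      ((l.map (Nat.cast : ℕ → ℤ)).take i).sum < ((raisedIndex l E).take i).sum := by
  obtain ⟨q, hq⟩ := hE
  -- The cut directly after the first index of a pair in $E$ separates that pair.
  refine ⟨q.1.1 + 1, q.1.1.2, ?_⟩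
  rw [sum_take_raisedIndex]
  refine lt_add_of_pos_right _ (Finset.sum_pos' (fun p _ => ?_) ⟨q, hq, ?_⟩)
  · have : (p.1.1 : ℕ) < (p.1.2 : ℕ) := p.2
    split_ifs <;> omega
  · have : (q.1.1 : ℕ) < (q.1.2 : ℕ) := q.2
    split_ifs <;> omega

/-- Only pairs with first index $i$ raise entry $i$; their second indices are distinct and differ
from $i$, so there are at most $m-1$ of them. -/
theorem raise_indicator_lt {m : ℕ} (E : Finset (IndexPair m)) (i : Fin m) :
    raise (fun p => if p ∈ E then 1 else 0) i < m := by
  classical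
  have h1 : raise (fun p => if p ∈ E then 1 else 0) i ≤
      ∑ p : IndexPair m, if p.1.1 = i then 1 else 0 := by
    rw [raise_apply]
    refine Finset.sum_le_sum fun p _ => ?_
    split_ifs <;> simp
  have h2 : (Finset.univ.filter fun p : IndexPair m => p.1.1 = i).card ≤
      (Finset.univ.erase i).card := by
    refine Finset.card_le_card_of_injOn (fun p => p.1.2) (fun p hp => ?_) fun p hp q hq h => ?_
    · simp only [Finset.coe_filter, Finset.mem_univ, true_and, Set.mem_ofPred_eq] at hp
      simp only [Finset.coe_erase, Finset.coe_univ, Set.mem_sdiff, Set.mem_univ, true_and,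
        Set.mem_singleton_iff]
      exact fun h => (p.2.trans_eq h).ne hp
    · simp only [Finset.coe_filter, Finset.mem_univ, true_and, Set.mem_ofPred_eq] at hp hq
      exact Subtype.ext (Prod.ext (hp.trans hq.symm) h)
  rw [Finset.card_erase_of_mem (Finset.mem_univ i), Finset.card_univ, Fintype.card_fin] at h2
  rw [Finset.sum_boole] at h1
  have := i.pos
  omega

theorem raisedIndex_le {l : List ℕ} {a k : ℕ} (ha : ∀ x ∈ l, x ≤ a) (hk : a + l.length ≤ k + 1)
    (E : Finset (IndexPair l.length)) : ∀ x ∈ raisedIndex l E, x ≤ k := by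
  intro x hx
  obtain ⟨i, rfl⟩ := List.mem_ofFn.mp hx
  have h1 := raise_indicator_lt E i
  have h2 := ha _ (l.get_mem i)
  omega

/-- With $f$ the split polynomial of the remaining parts and $g$ its leading term, this isolates the
two sources of error: lower blocks, and nonempty raisings in the current block. -/
theorem partitionB_sub (l : List ℕ) (f g : Sym) :
    partitionB l f - vertexWord (raisedIndex l ∅) g =
      (∑ E : Finset (IndexPair l.length), (-t) ^ E.card • vertexWord (raisedIndex l E) (f - g)) +
        ∑ E ∈ Finset.univ.erase (∅ : Finset (IndexPair l.length)),
          (-t) ^ E.card • vertexWord (raisedIndex l E) g := by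
  have h1 : partitionB l f =
      (∑ E : Finset (IndexPair l.length), (-t) ^ E.card • vertexWord (raisedIndex l E) (f - g)) +
        ∑ E : Finset (IndexPair l.length), (-t) ^ E.card • vertexWord (raisedIndex l E) g := by
    rw [partitionB_eq, ← Finset.sum_add_distrib]
    refine Finset.sum_congr rfl fun E _ => ?_
    rw [← smul_add, ← vertexWord_add, sub_add_cancel]
  have h2 := Finset.add_sum_erase Finset.univ (fun E : Finset (IndexPair l.length) =>
    (-t) ^ E.card • vertexWord (raisedIndex l E) g) (Finset.mem_univ ∅)
  rw [Finset.card_empty, pow_zero, one_smul] at h2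
  rw [h1, ← h2, add_sub_assoc, add_sub_cancel_left]

theorem hasExpansion_kSplitPoly_sub {k : ℕ} (l : List ℕ) (hl : IsPartition l)
    (hk : ∀ x ∈ l, x ≤ k) :
    HasExpansion (fun μ : BoundedPartition k => DominanceLT l μ.1)
      (kSplitPoly k l - hallLittlewoodH l) := by
  induction hlen : l.length using Nat.strong_induction_on generalizing l with
  | _ d ih =>
    subst hlen
    rcases l with _ | ⟨a, l⟩
    · have h1 : hallLittlewoodH [] = 1 := by rw [hallLittlewoodH_eq_vertexWord]; rfl
      have h2 : kSplitPoly k [] = 1 := by simp [kSplitPoly, kSplit, generalizedSchur]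
      rw [h1, h2, sub_self]
      exact HasExpansion.zero
    set b := a :: l.take (k - a) with hb
    set r := l.drop (k - a) with hr
    have hsplit : a :: l = b ++ r := by simp [hb, hr]
    have hG : kSplitPoly k (a :: l) = partitionB b (kSplitPoly k r) := by
      simp [kSplitPoly, kSplit, generalizedSchur, hb, hr]
    have hrp : IsPartition r := by
      refine ⟨((List.pairwise_append.mp (hsplit ▸ hl.1.pairwise)).2.1).sortedGE, fun x hx => ?_⟩
      exact hl.2 x (by rw [hsplit]; simp [hx])
    have hrk : ∀ x ∈ r, x ≤ k := fun x hx => hk x (by rw [hsplit]; simp [hx])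
    -- The block has at most $k-a+1$ parts and $a\le k$, so its main hook-length is at most $k$.
    have hbk : ∀ E, ∀ x ∈ raisedIndex b E, x ≤ k := by
      have hak := hk a (by simp)
      refine raisedIndex_le (a := a) (fun x hx => ?_) ?_
      · rcases List.mem_cons.mp hx with rfl | hx
        · exact le_rfl
        · exact (List.pairwise_cons.mp hl.1.pairwise).1 x (List.mem_of_mem_take hx)
      · rw [hb, List.length_cons, List.length_take]
        omega
    have hrest := ih r.length (by rw [hr, List.length_drop, List.length_cons]; omega) r hrp hrk rfl
    have key : ∀ E, ∀ ν : BoundedPartition k,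
        HasExpansion (fun μ : BoundedPartition k =>
          DominanceLE (raisedIndex b E ++ ν.1.map Nat.cast) (μ.1.map Nat.cast))
          (vertexWord (raisedIndex b E) (hallLittlewoodH ν.1)) := by
      intro E ν
      rw [hallLittlewoodH_eq_vertexWord, ← vertexWord_append]
      refine hasExpansion_vertexWord k _ fun x hx => ?_
      rcases List.mem_append.mp hx with hx | hx
      · exact hbk E x hx
      · obtain ⟨y, hy, rfl⟩ := List.mem_map.mp hx
        exact_mod_cast ν.2.2 y hy
    have hle : ∀ E, ∀ ν : List ℕ, DominanceLE (r.map Nat.cast) (ν.map Nat.cast) →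
        DominanceLE ((a :: l).map Nat.cast) (raisedIndex b E ++ ν.map Nat.cast) := by
      intro E ν hν
      rw [hsplit, List.map_append]
      exact ((dominanceLE_append_iff _ _ _).mpr hν).trans (dominanceLE_append_right _
        (dominanceLE_raisedIndex b E) (by rw [length_raisedIndex, List.length_map]))
    have hlt : ∀ E : Finset (IndexPair b.length), E.Nonempty → ∀ ν : List ℕ,
        DominanceLE (r.map Nat.cast) (ν.map Nat.cast) → ∀ μ : BoundedPartition k,
        DominanceLE (raisedIndex b E ++ ν.map Nat.cast) (μ.1.map Nat.cast) →
          DominanceLT (a :: l) μ.1 := by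
      intro E hE ν hν μ hμ
      rw [dominanceLT_iff]
      refine ⟨?_, (hle E ν hν).trans hμ⟩
      intro heq
      -- The strict increase happens at a cut inside the first block, where the tail $\nu$ has no
      -- influence.
      obtain ⟨i, hi, hlt⟩ := exists_sum_take_lt_raisedIndex b hE
      have := hμ.2 i
      rw [← heq, hsplit, List.map_append, List.take_append_of_le_length (by rwa [length_raisedIndex]),
        List.take_append_of_le_length (by simpa using hi)] at this
      exact absurd this (not_le.mpr hlt)
    -- Here strictness comes from the tail: if $\mu$ were the original partition, cancelling the
    -- common block would give dominance between $r$ and $\nu$ in both directions.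
    have hempty : ∀ ν : BoundedPartition k, DominanceLT r ν.1 → ∀ μ : BoundedPartition k,
        DominanceLE (raisedIndex b ∅ ++ ν.1.map Nat.cast) (μ.1.map Nat.cast) →
          DominanceLT (a :: l) μ.1 := by
      intro ν hν μ hμ
      rw [dominanceLT_iff] at hν ⊢
      refine ⟨fun heq => hν.1 ?_, (hle ∅ ν.1 hν.2).trans hμ⟩
      rw [← heq, hsplit, raisedIndex_empty, List.map_append, dominanceLE_append_iff] at hμ
      exact eq_of_dominanceLE hrp.2 ν.2.1.2 hν.2 hμ
    have hH : hallLittlewoodH (a :: l) = vertexWord (raisedIndex b ∅) (hallLittlewoodH r) := by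
      rw [hallLittlewoodH_eq_vertexWord, hallLittlewoodH_eq_vertexWord, raisedIndex_empty,
        ← vertexWord_append, hsplit, List.map_append]
    rw [hG, hH, partitionB_sub]
    refine (HasExpansion.sum fun E _ => (HasExpansion.vertexWord _ hrest fun ν hν =>
      (key E ν).mono fun μ hμ => ?_).neg_t_pow_smul _).add
      (HasExpansion.sum fun E hE => ((key E ⟨r, hrp, hrk⟩).mono fun μ hμ => ?_).neg_t_pow_smul _)
    · rcases E.eq_empty_or_nonempty with rfl | hE
      · exact hempty ν hν μ hμ
      · exact hlt E hE ν.1 ((dominanceLT_iff _ _).mp hν).2 μ hμ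
    · exact hlt E (Finset.nonempty_iff_ne_empty.mpr (Finset.ne_of_mem_erase hE)) r
        (DominanceLE.refl _) μ hμ

/-! ### Linear independence of the Hall-Littlewood functions -/

theorem linearIndependent_of_triangular {ι K V : Type*} [Field K] [AddCommGroup V] [Module K V]
    {v : ι → V} (ε : ι → V →ₗ[K] K) (w : ι → ℕ) (h1 : ∀ i, ε i (v i) = 1)
    (h2 : ∀ i j, i ≠ j → ε i (v j) ≠ 0 → w j < w i) : LinearIndependent K v := by
  classical
  rw [linearIndependent_iff']
  intro s g hg i hi
  induction hw : w i using Nat.strong_induction_on generalizing i with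
  | _ d ih =>
    subst hw
    have h := congrArg (ε i) hg
    rw [map_sum, map_zero, Finset.sum_eq_single_of_mem i hi] at h
    · simpa [h1] using h
    · intro j hj hji
      rw [map_smul]
      by_cases h0 : ε i (v j) = 0
      · rw [h0, smul_zero]
      · rw [ih (w j) (h2 i j hji.symm h0) j hj rfl, zero_smul]

/-- The exponent of the variable with index `n`, and `0` for `n = 0`. -/
def partExponent : ℕ → ℕ+ →₀ ℕ
  | 0 => 0
  | n + 1 => Finsupp.single n.succPNat 1

/-- The polynomial in complete symmetric functions which gives the power sum `p_{r + 1}`. -/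
def powerSumInComplete : ℕ → Sym
  | r => ((r : Scalar) + 1) • monomial (partExponent (r + 1)) 1 -
      ∑ i : Fin r, powerSumInComplete i * monomial (partExponent (r - i)) 1
termination_by r => r
decreasing_by exact i.2

/-- The coordinates of symmetric functions with respect to the complete symmetric functions: the
homomorphism which sends `h_n` to the variable with index `n`. -/
def completeCoordinates : Sym →ₐ[Scalar] Sym :=
  MvPolynomial.aeval fun n => powerSumInComplete n.natPred

/-- Newton's identity solved for $p_{r+1}$ defines the images of the power sums; solving it back for
$h_{r+1}$ recovers the variable. -/
theorem completeCoordinates_complete (r : ℕ) :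
    completeCoordinates (complete r) = monomial (partExponent r) 1 := by
  induction r using Nat.strong_induction_on with
  | _ r ih =>
    rcases r with _ | r
    · rw [Nat.cast_zero, complete_zero, map_one]
      rfl
    have hr : (((r + 1 : ℕ) : ℤ) : Scalar) ≠ 0 := by exact_mod_cast Nat.succ_ne_zero r
    refine smul_right_injective _ hr ?_
    change (((r + 1 : ℕ) : ℤ) : Scalar) • _ = (((r + 1 : ℕ) : ℤ) : Scalar) • _
    rw [← map_smul, smul_complete _ (r + 1) le_rfl, map_sum]
    have hX : ∀ i : ℕ, completeCoordinates (powerSum i.succPNat) = powerSumInComplete i := by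
      intro i
      simp [completeCoordinates, powerSum]
    have step : ∀ i ∈ Finset.range (r + 1),
        completeCoordinates (powerSum i.succPNat * complete (((r + 1 : ℕ) : ℤ) - 1 - i)) =
          powerSumInComplete i * monomial (partExponent (r - i)) 1 := by
      intro i hi
      rw [Finset.mem_range] at hi
      rw [map_mul, hX, show ((r + 1 : ℕ) : ℤ) - 1 - i = (r - i : ℕ) by omega, ih _ (by omega)]
    rw [Finset.sum_congr rfl step, Finset.sum_range_succ, Nat.sub_self]
    conv_lhs => enter [2, 1]; rw [powerSumInComplete]
    rw [← Finset.sum_range fun i => powerSumInComplete i * monomial (partExponent (r - i)) 1]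
    have h0 : (monomial (partExponent 0) 1 : Sym) = 1 := rfl
    rw [h0, mul_one, add_sub_cancel]
    push_cast
    rfl

theorem completeCoordinates_prod {m : ℕ} (β : Fin m → ℕ) :
    completeCoordinates (∏ i, complete (β i)) = monomial (∑ i, partExponent (β i)) 1 := by
  rw [map_prod]
  simp only [completeCoordinates_complete]
  exact (monomial_sum_one _ _).symm

/-- The sum of the squares of the parts. -/
def squareWeight : (ℕ+ →₀ ℕ) →+ ℕ := Finsupp.weight fun n : ℕ+ => (n : ℕ) ^ 2

theorem squareWeight_partExponent (n : ℕ) : squareWeight (partExponent n) = n ^ 2 := by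
  rcases n with _ | n
  · simp [partExponent]
  · simp [partExponent, squareWeight, Finsupp.weight_apply]

/-- With $v$ the raising vector, $|\alpha+v|^2=|\alpha|^2+2\langle\alpha,v\rangle+|v|^2$. The middle
term is nonnegative because $\alpha$ is weakly decreasing, and $v\ne0$. -/
theorem sum_sq_lt_sum_sq_add_raise {m : ℕ} {α : Fin m → ℤ} (hα : Antitone α)
    {n : IndexPair m → ℕ} (hn : n ≠ 0) : ∑ i, α i ^ 2 < ∑ i, (α i + raise n i) ^ 2 := by
  have h1 : ∑ i, (α i + raise n i) ^ 2 =
      ∑ i, α i ^ 2 + 2 * ∑ i, α i * raise n i + ∑ i, raise n i ^ 2 := by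
    rw [Finset.mul_sum, ← Finset.sum_add_distrib, ← Finset.sum_add_distrib]
    exact Finset.sum_congr rfl fun i _ => by ring
  have h2 : 0 ≤ ∑ i, α i * raise n i := by
    rw [sum_mul_raise]
    exact Finset.sum_nonneg fun p _ => mul_nonneg (by positivity) (sub_nonneg.mpr (hα p.2.le))
  have h3 : 0 < ∑ i, raise n i ^ 2 := by
    refine lt_of_le_of_ne (Finset.sum_nonneg fun i _ => sq_nonneg _) fun h => ?_
    have h4 : ∀ i, raise n i = 0 := fun i => by
      have := (Finset.sum_eq_zero_iff_of_nonneg fun i _ => sq_nonneg (raise n i)).mp h.symm i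
        (Finset.mem_univ i)
      exact pow_eq_zero_iff two_ne_zero |>.mp this
    -- The strictly decreasing weight $-i$ pairs positively with each $\varepsilon_i-\varepsilon_j$,
    -- so a nonzero nonnegative combination cannot vanish.
    have h5 := sum_mul_raise (fun i : Fin m => -(i : ℤ)) n
    simp only [h4, mul_zero, Finset.sum_const_zero] at h5
    obtain ⟨p, hp⟩ := Function.ne_iff.mp hn
    have h6 : ∀ q : IndexPair m, (0 : ℤ) < -((q.1.1 : ℕ) : ℤ) - -((q.1.2 : ℕ) : ℤ) := fun q => by
      have : (q.1.1 : ℕ) < (q.1.2 : ℕ) := q.2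
      omega
    have h7 : 0 < ∑ p : IndexPair m, (n p : ℤ) * (-((p.1.1 : ℕ) : ℤ) - -((p.1.2 : ℕ) : ℤ)) := by
      refine Finset.sum_pos' (fun q _ => mul_nonneg (by positivity) (h6 q).le)
        ⟨p, Finset.mem_univ p, mul_pos ?_ (h6 p)⟩
      exact_mod_cast Nat.pos_of_ne_zero hp
    exact h7.ne h5
  linarith

/-- The exponent of the monomial `h_{l_1} h_{l_2} ⋯`. -/
def listExponent (l : List ℕ) : ℕ+ →₀ ℕ := ∑ i : Fin l.length, partExponent (l.get i)

theorem listExponent_apply (l : List ℕ) (n : ℕ+) : listExponent l n = l.count (n : ℕ) := by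
  induction l with
  | nil => simp [listExponent]
  | cons a l ih =>
    have h : listExponent (a :: l) = partExponent a + listExponent l := Fin.sum_univ_succ _
    rw [h, Finsupp.add_apply, ih, List.count_cons, add_comm]
    congr 1
    rcases a with _ | a
    · simp [partExponent, n.ne_zero.symm]
    · simp only [partExponent, Finsupp.single_apply, beq_iff_eq]
      refine if_congr ?_ rfl rfl
      rw [← PNat.coe_inj, Nat.succPNat_coe]

theorem listExponent_injOn {l m : List ℕ} (hl : IsPartition l) (hm : IsPartition m)
    (h : listExponent l = listExponent m) : l = m := by
  refine List.Perm.eq_of_sortedGE hl.1 hm.1 (List.perm_iff_count.mpr fun a => ?_)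
  rcases a.eq_zero_or_pos with rfl | ha
  · rw [List.count_eq_zero.mpr fun h0 => (hl.2 0 h0).ne rfl,
      List.count_eq_zero.mpr fun h0 => (hm.2 0 h0).ne rfl]
  · have := DFunLike.congr_fun h ⟨a, ha⟩
    exact (listExponent_apply l ⟨a, ha⟩).symm.trans (this.trans (listExponent_apply m ⟨a, ha⟩))

theorem squareWeight_listExponent (l : List ℕ) :
    (squareWeight (listExponent l) : ℤ) = ∑ i : Fin l.length, (l.get i : ℤ) ^ 2 := by
  rw [listExponent, map_sum]
  simp only [squareWeight_partExponent]
  push_cast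
  rfl

/-- The coefficient of `h_{l_1} h_{l_2} ⋯` in the expansion of a symmetric function in products
of complete symmetric functions. -/
def completeCoeff (l : List ℕ) : Sym →ₗ[Scalar] Scalar :=
  (MvPolynomial.lcoeff Scalar (listExponent l)).comp completeCoordinates.toLinearMap

theorem completeCoeff_prod (l : List ℕ) {m : ℕ} (β : Fin m → ℕ) :
    completeCoeff l (∏ i, complete (β i)) =
      if ∑ i, partExponent (β i) = listExponent l then 1 else 0 := by
  change coeff _ (completeCoordinates _) = _
  rw [completeCoordinates_prod, coeff_monomial]

theorem completeCoeff_raisedTerm_ne_zero {l m : List ℕ} (hm : IsPartition m)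
    {n : IndexPair m.length → ℕ} (hn : n ≠ 0)
    (h : completeCoeff l (raisedTerm (fun i => (m.get i : ℤ)) n) ≠ 0) :
    squareWeight (listExponent m) < squareWeight (listExponent l) := by
  have hpos := support_raisedTerm_subset (fun i => (m.get i : ℤ)) (fun h0 => h (by rw [h0, map_zero]) :
    n ∈ Function.support (raisedTerm fun i => (m.get i : ℤ)))
  obtain ⟨β, hβ⟩ : ∃ β : Fin m.length → ℕ, ∀ i, (m.get i : ℤ) + raise n i = β i :=
    ⟨fun i => ((m.get i : ℤ) + raise n i).toNat, fun i => (Int.toNat_of_nonneg (hpos i)).symm⟩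
  rw [raisedTerm, map_smul] at h
  simp only [hβ] at h
  rw [completeCoeff_prod] at h
  have hl : ∑ i, partExponent (β i) = listExponent l := by
    by_contra h0
    rw [if_neg h0, smul_zero] at h
    exact h rfl
  have hanti : Antitone fun i : Fin m.length => (m.get i : ℤ) :=
    fun i j hij => Nat.cast_le.mpr (hm.1.antitone_get hij)
  have hlt := sum_sq_lt_sum_sq_add_raise hanti hn
  simp only [hβ] at hlt
  rw [← squareWeight_listExponent] at hlt
  rw [← hl, map_sum]
  simp only [squareWeight_partExponent]
  exact_mod_cast hlt

/-- Only the term without raising can contribute, since all others have a larger sum of squares than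
$m$. -/
theorem completeCoeff_hallLittlewoodH {l m : List ℕ} (hl : IsPartition l) (hm : IsPartition m)
    (h : ¬ squareWeight (listExponent m) < squareWeight (listExponent l)) :
    completeCoeff l (hallLittlewoodH m) = if l = m then 1 else 0 := by
  have h1 : completeCoeff l (hallLittlewoodH m) =
      ∑ᶠ n, completeCoeff l (raisedTerm (fun i => (m.get i : ℤ)) n) := by
    rw [hallLittlewoodH_eq_finsum]
    exact AddMonoidHom.map_finsum (completeCoeff l).toAddMonoidHom (finite_support_raisedTerm _)
  rw [h1, finsum_eq_single _ 0 fun n hn => ?_]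
  · have h2 : raisedTerm (fun i => (m.get i : ℤ)) 0 = ∏ i, complete (m.get i : ℕ) := by
      have : raise (0 : IndexPair m.length → ℕ) = 0 := raise_zero
      simp [raisedTerm, raisingCoeff, this]
    rw [h2, completeCoeff_prod]
    refine if_congr ⟨fun h0 => listExponent_injOn hl hm h0.symm, ?_⟩ rfl rfl
    rintro rfl
    rfl
  · by_contra h0
    exact h (completeCoeff_raisedTerm_ne_zero hm hn h0)

theorem linearIndependent_hallLittlewoodH (k : ℕ) :
    LinearIndependent Scalar fun l : BoundedPartition k => hallLittlewoodH l.1 := by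
  refine linearIndependent_of_triangular (fun l => completeCoeff l.1)
    (fun l => squareWeight (listExponent l.1)) (fun l => ?_) fun l m hlm h => ?_
  · rw [completeCoeff_hallLittlewoodH l.2.1 l.2.1 (lt_irrefl _), if_pos rfl]
  · by_contra h0
    rw [completeCoeff_hallLittlewoodH l.2.1 m.2.1 h0, if_neg fun h1 => hlm (Subtype.ext h1)] at h
    exact h rfl

/-! ### The basis of `k`-split polynomials -/

/-- The sum of all partial sums of a list. -/
def dominanceRank (l : List ℕ) : ℕ := ∑ i ∈ Finset.range (l.sum + 1), (l.take i).sum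

theorem sum_take_le (l : List ℕ) (i : ℕ) : (l.take i).sum ≤ l.sum := by
  conv_rhs => rw [← List.take_append_drop i l, List.sum_append]
  exact Nat.le_add_right _ _

theorem dominanceRank_le (l : List ℕ) : dominanceRank l ≤ (l.sum + 1) * l.sum := by
  refine (Finset.sum_le_card_nsmul _ _ l.sum fun i _ => sum_take_le l i).trans ?_
  simp

theorem length_le_sum {l : List ℕ} (hl : ∀ x ∈ l, 0 < x) : l.length ≤ l.sum :=
  List.length_le_sum_of_one_le l hl

/-- Positive parts force the length to be at most the size, so the partial sums in the rank already
determine the partition. -/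
theorem dominanceRank_lt {l m : List ℕ} (hl : ∀ x ∈ l, 0 < x) (hm : ∀ x ∈ m, 0 < x)
    (h : DominanceLT l m) : dominanceRank l < dominanceRank m := by
  obtain ⟨hne, hsum, hle⟩ := h
  rw [dominanceRank, dominanceRank, hsum]
  refine Finset.sum_lt_sum (fun i _ => hle i) ?_
  by_contra! hc
  refine hne (eq_of_sum_take_eq hl hm fun i => (hle i).antisymm ?_)
  by_cases hi : i ∈ Finset.range (m.sum + 1)
  · exact hc i hi
  · rw [Finset.mem_range] at hi
    have h1 := length_le_sum hl
    rw [List.take_of_length_le (l := l) (by omega), hsum]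
    exact sum_take_le m i

theorem HasExpansion.mem_LambdaT {k : ℕ} {S : BoundedPartition k → Prop} {f : Sym}
    (h : HasExpansion S f) : f ∈ LambdaT k := by
  obtain ⟨g, -, rfl⟩ := h
  rw [combination_apply]
  exact Submodule.sum_mem _ fun m _ =>
    Submodule.smul_mem _ _ (Submodule.subset_span (Set.mem_range_self m))

theorem kSplitPoly_mem_LambdaT {k : ℕ} (l : BoundedPartition k) :
    kSplitPoly k l.1 ∈ LambdaT k := by
  rw [← sub_add_cancel (kSplitPoly k l.1) (hallLittlewoodH l.1)]
  exact Submodule.add_mem _ (hasExpansion_kSplitPoly_sub l.1 l.2.1 l.2.2).mem_LambdaT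
    (Submodule.subset_span (Set.mem_range_self l))

/-- The basis of Hall-Littlewood functions of `Λ_t^(k)`. -/
def hallLittlewoodBasis (k : ℕ) : Module.Basis (BoundedPartition k) Scalar (LambdaT k) :=
  Module.Basis.span (linearIndependent_hallLittlewoodH k)

theorem coe_hallLittlewoodBasis {k : ℕ} (l : BoundedPartition k) :
    (hallLittlewoodBasis k l : Sym) = hallLittlewoodH l.1 :=
  congrArg Subtype.val (Module.Basis.span_apply (linearIndependent_hallLittlewoodH k) l)

theorem exists_kSplitPoly_eq {k : ℕ} (l : BoundedPartition k) :
    ∃ g : BoundedPartition k →₀ Polynomial ℤ, (∀ m ∈ g.support, DominanceLT l.1 m.1) ∧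
      kSplitPoly k l.1 = hallLittlewoodH l.1 +
        ∑ m ∈ g.support, Polynomial.aeval t (g m) • hallLittlewoodH m.1 := by
  obtain ⟨g, hg, h⟩ := hasExpansion_kSplitPoly_sub l.1 l.2.1 l.2.2
  exact ⟨g, hg, by rw [← combination_apply, ← h, add_sub_cancel]⟩

theorem linearIndependent_kSplitPoly (k : ℕ) : LinearIndependent Scalar
    fun l : BoundedPartition k => (⟨kSplitPoly k l.1, kSplitPoly_mem_LambdaT l⟩ : LambdaT k) := by
  have hcoord : ∀ l m : BoundedPartition k, ¬ dominanceRank m.1 < dominanceRank l.1 →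
      (hallLittlewoodBasis k).coord l ⟨kSplitPoly k m.1, kSplitPoly_mem_LambdaT m⟩ =
        if m = l then 1 else 0 := by
    classical
    intro l m hlm
    obtain ⟨g, hg, h⟩ := exists_kSplitPoly_eq m
    have h' : (⟨kSplitPoly k m.1, kSplitPoly_mem_LambdaT m⟩ : LambdaT k) =
        hallLittlewoodBasis k m +
          ∑ m' ∈ g.support, Polynomial.aeval t (g m') • hallLittlewoodBasis k m' := by
      refine Subtype.ext ?_
      simp only [Submodule.coe_add, Submodule.coe_sum, Submodule.coe_smul, coe_hallLittlewoodBasis]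
      exact h
    rw [h', map_add, map_sum, Finset.sum_eq_zero, add_zero, Module.Basis.coord_apply,
      Module.Basis.repr_self, Finsupp.single_apply]
    intro m' hm'
    rw [map_smul, Module.Basis.coord_apply, Module.Basis.repr_self, Finsupp.single_eq_of_ne,
      smul_zero]
    rintro rfl
    exact hlm (dominanceRank_lt m.2.1.2 l.2.1.2 (hg _ hm'))
  refine linearIndependent_of_triangular (hallLittlewoodBasis k).coord
    (fun l => dominanceRank l.1) (fun l => ?_) fun l m hlm h => ?_
  · rw [hcoord l l (lt_irrefl _), if_pos rfl]
  · by_contra h0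
    rw [hcoord l m h0, if_neg hlm.symm] at h
    exact h rfl

/-- Downward induction on dominance: solve the triangular expansion for its leading term. The rank
is bounded in each size, so its distance to the bound is a valid measure. -/
theorem hallLittlewoodH_mem_span {k : ℕ} (l : BoundedPartition k) :
    hallLittlewoodH l.1 ∈
      Submodule.span Scalar (Set.range fun l : BoundedPartition k => kSplitPoly k l.1) := by
  induction hd : (l.1.sum + 1) * l.1.sum - dominanceRank l.1 using Nat.strong_induction_on
    generalizing l with
  | _ d ih =>
    subst hd
    obtain ⟨g, hg, h⟩ := exists_kSplitPoly_eq l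
    rw [eq_sub_of_add_eq h.symm]
    refine Submodule.sub_mem _ (Submodule.subset_span (Set.mem_range_self l))
      (Submodule.sum_mem _ fun m hm => Submodule.smul_mem _ _ (ih _ ?_ m rfl))
    have h1 := dominanceRank_lt l.2.1.2 m.2.1.2 (hg m hm)
    have h2 := dominanceRank_le m.1
    rw [(hg m hm).2.1]
    omega

theorem top_le_span_kSplitPoly (k : ℕ) : ⊤ ≤ Submodule.span Scalar (Set.range
    fun l : BoundedPartition k => (⟨kSplitPoly k l.1, kSplitPoly_mem_LambdaT l⟩ : LambdaT k)) := by
  have h : LambdaT k ≤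
      Submodule.span Scalar (Set.range fun l : BoundedPartition k => kSplitPoly k l.1) := by
    refine Submodule.span_le.mpr ?_
    rintro _ ⟨l, rfl⟩
    exact hallLittlewoodH_mem_span l
  rintro ⟨f, hf⟩ -
  have hf' := h hf
  -- The span inside the subspace is compared with the ambient span through the injective inclusion.
  refine (Submodule.mem_map.mp (?_ : f ∈ Submodule.map (LambdaT k).subtype _)).elim
    fun x hx => (Subtype.ext hx.2 : x = ⟨f, hf⟩) ▸ hx.1
  rw [Submodule.map_span, ← Set.range_comp]
  exact hf'

end KSplit

end

theorem mainTheorem2 (k : ℕ) (hk : 0 < k) :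
    (∃ b : Module.Basis (KSplit.BoundedPartition k) KSplit.Scalar (KSplit.LambdaT k),
      ∀ l : KSplit.BoundedPartition k, (b l : KSplit.Sym) = KSplit.kSplitPoly k l.1) ∧
    (∀ l : KSplit.BoundedPartition k,
      ∃ g : KSplit.BoundedPartition k →₀ Polynomial ℤ,
        (∀ m ∈ g.support, KSplit.DominanceLT l.1 m.1) ∧
        KSplit.kSplitPoly k l.1 = KSplit.hallLittlewoodH l.1 +
          ∑ m ∈ g.support, Polynomial.aeval KSplit.t (g m) • KSplit.hallLittlewoodH m.1) := by
  refine ⟨⟨Module.Basis.mk (KSplit.linearIndependent_kSplitPoly k)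
    (KSplit.top_le_span_kSplitPoly k), fun l => ?_⟩, KSplit.exists_kSplitPoly_eq⟩
  rw [Module.Basis.mk_apply]
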